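/- An \emph{$n$-space group} is a discrete group $\Gamma$ of isometries of Euclidean $n$-space $E^n$ with compact orbit space $E^n/\Gamma$. Write $a+A$ for the affine map $x\mapsto a+Ax$. For a normal subgroup $N$ of $\Gamma$ let $\mathrm{Span}(N)$ be the linear span of $\{a : a+I\in N\}$; $N$ is \emph{complete} if, with $V=\mathrm{Span}(N)$, $N=\{a+A\in\Gamma : a\in V,\ A \text{ fixes } V^\perp \text{ pointwise}\}$. For an $m$-space group $M$, let $\mathrm{Aff}(M)=\mathrm{Aff}(E^m/M)$ be the group of bijections $\beta$ of $E^m/M$ that lift to an affinity $\tilde\beta$ of $E^m$, i.e. $\beta(Mx)=M\tilde\beta(x)$ for all $x$, and let $\Omega:\mathrm{Aff}(M)\to\mathrm{Out}(M)$ be the homomorphism sending $\beta$ to the class of the automorphism $\mu\mapsto\tilde\beta\mu\tilde\beta^{-1}$ of $M$. Let $\mathrm{Isom}(E^m/M)$ be the group of isometries of $E^m/M$ for the distance between orbits. Let $0<m<n$, let $M$ be an $m$-space group and $\Delta$ an $(n-m)$-space group. $\mathrm{Hom}_f(\Delta,\mathrm{Aff}(M))$ is the set of homomorphisms $\eta:\Delta\to\mathrm{Aff}(M)$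 such that $\Omega\eta$ has finite image, and $\mathrm{Aff}(\Delta,M)=(\mathrm{Aff}(M)\backslash\mathrm{Hom}_f(\Delta,\mathrm{Aff}(M)))/\mathrm{Out}(\Delta)$ is its set of classes $[\eta]$ modulo conjugation by elements of $\mathrm{Aff}(M)$ and precomposition with automorphisms of $\Delta$. Likewise $\mathrm{Out}(\Delta,M)$ is the set of homomorphisms $\Delta\to\mathrm{Out}(M)$ with finite image modulo conjugation by $\mathrm{Out}(M)$ and precomposition with automorphisms of $\Delta$. $\mathrm{Iso}(\Delta,M)$ is the set of isomorphism classes $[\Gamma,N]$ of pairs $(\Gamma,N)$, where $\Gamma$ is an $n$-space group, $N$ is a complete normal subgroup of $\Gamma$, $N\cong M$ and $\Gamma/N\cong\Delta$; an isomorphism of pairs $(\Gamma_1,N_1)\to(\Gamma_2,N_2)$ is a group isomorphism $\Gamma_1\to\Gamma_2$ mapping $N_1$ onto $N_2$. The map $\psi:\mathrm{Aff}(\Delta,M)\to\mathrm{Iso}(\Delta,M)$ is defined as follows. For $C\in\mathrm{GL}(m,\mathbb R)$ let $C_\star:E^m/M\to E^m/CMC^{-1}$, $C_\star(Mx)=CMC^{-1}(Cx)$,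 and $C_\sharp(\beta)=C_\star\beta C_\star^{-1}$. Given $\eta\in\mathrm{Hom}_f(\Delta,\mathrm{Aff}(M))$, there are a $C\in\mathrm{GL}(m,\mathbb R)$ such that $CMC^{-1}$ is an $m$-space group and $C_\sharp\eta(\Delta)\subseteq\mathrm{Isom}(E^m/CMC^{-1})$, and an $n$-space group $\Gamma$ of isometries of $E^n=E^m\times E^{n-m}$ such that: $N=\{\mu\times 1:\mu\in CMC^{-1}\}$ is a complete normal subgroup of $\Gamma$; every $\gamma\in\Gamma$ is a product $\gamma=\overline\gamma\times\gamma'$ of affinities of $E^m$ and $E^{n-m}$; $\{\gamma':\gamma\in\Gamma\}=\Delta$; and, for every $\gamma\in\Gamma$, the self-map of $E^m/CMC^{-1}$ induced by $\overline\gamma$ is $C_\sharp\eta(\gamma')$. Then $\psi([\eta])=[\Gamma,N]$; this class depends only on $[\eta]$, not on the choices. The map $\omega:\mathrm{Iso}(\Delta,M)\to\mathrm{Out}(\Delta,M)$ is defined by $\omega([\Gamma,N])=[\alpha_\#\mathcal O\beta]$, where $\mathcal O:\Gamma/N\to\mathrm{Out}(N)$ is induced by conjugation, $\alpha:N\to M$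 and $\beta:\Delta\to\Gamma/N$ are any isomorphisms, and $\alpha_\#:\mathrm{Out}(N)\to\mathrm{Out}(M)$ is induced by $\alpha$; the homomorphism $\alpha_\#\mathcal O\beta$ has finite image, and its class depends only on $[\Gamma,N]$. \textbf{Theorem.} If the center of $M$ is trivial, then the maps $\psi:\mathrm{Aff}(\Delta,M)\to\mathrm{Iso}(\Delta,M)$ and $\omega:\mathrm{Iso}(\Delta,M)\to\mathrm{Out}(\Delta,M)$ are well defined and are bijections. -/

import Mathlib

noncomputable section

namespace FlatOrbifold

/-! ### Outer automorphism groups -/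

section Out

variable {G H : Type*} [Group G] [Group H]

/-- The group `Inn(G)` of inner automorphisms, as a subgroup of `Aut(G)`. -/
def inner (G : Type*) [Group G] : Subgroup (MulAut G) := (MulAut.conj : G →* MulAut G).range

instance inner_normal (G : Type*) [Group G] : (inner G).Normal := by
  refine ⟨?_⟩
  rintro _ ⟨g, rfl⟩ a
  refine ⟨a g, ?_⟩
  ext x
  simp [MulAut.conj_apply]

/-- The outer automorphism group `Out(G) = Aut(G)/Inn(G)`. -/
abbrev Out (G : Type*) [Group G] : Type _ := MulAut G ⧸ inner G

/-- The isomorphism `α_# : Out(G) → Out(H)`, `ζ Inn(G) ↦ α ζ α⁻¹ Inn(H)`, induced by an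
isomorphism `α : G → H`. -/
def outCongr (α : G ≃* H) : Out G ≃* Out H :=
  QuotientGroup.congr (inner G) (inner H) (MulAut.congr α) (by
    ext f
    constructor
    · rintro ⟨_, ⟨g, rfl⟩, rfl⟩
      refine ⟨α g, ?_⟩
      ext x
      simp [MulAut.congr, MulAut.conj_apply]
    · rintro ⟨h, rfl⟩
      refine ⟨MulAut.conj (α.symm h), ⟨_, rfl⟩, ?_⟩
      ext x
      simp [MulAut.congr, MulAut.conj_apply])

theorem outCongr_mk (α : G ≃* H) (ζ : MulAut G) :
    outCongr α (QuotientGroup.mk ζ) =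
      (QuotientGroup.mk ((α.symm.trans ζ).trans α : MulAut H) : Out H) := rfl

/-- For a normal subgroup `N` of `G`, the homomorphism `𝒪 : G/N → Out(N)` induced by the action
of `G` on `N` by conjugation. -/
def conjOut (N : Subgroup G) [N.Normal] : G ⧸ N →* Out N :=
  QuotientGroup.lift N ((QuotientGroup.mk' (inner N)).comp MulAut.conjNormal) (by
    intro g hg
    refine (QuotientGroup.eq_one_iff _).2 ⟨⟨g, hg⟩, ?_⟩
    ext x
    simp [MulAut.conj_apply, MulAut.conjNormal_apply])

theorem conjOut_mk (N : Subgroup G) [N.Normal] (g : G) :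
    conjOut N (g : G ⧸ N) = (QuotientGroup.mk (MulAut.conjNormal g) : Out N) := rfl

end Out

/-! ### Space groups and their orbit spaces -/

/-- Euclidean `n`-space. -/
abbrev E (n : ℕ) : Type := EuclideanSpace ℝ (Fin n)

/-- The group of affinities of Euclidean `n`-space. -/
abbrev Aff (n : ℕ) : Type := E n ≃ᵃ[ℝ] E n

/-- Affinities act on Euclidean space by evaluation. -/
instance affAction (n : ℕ) : MulAction (Aff n) (E n) where
  smul g x := g x
  one_smul _ := rfl
  mul_smul _ _ _ := rfl

/-- An affinity as a continuous self-map of Euclidean space. -/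
def toC {n : ℕ} (g : Aff n) : C(E n, E n) := ⟨g, g.continuous_of_finiteDimensional⟩

/-- The orbit space `Eⁿ/Γ`, with the quotient topology. -/
abbrev Orb {n : ℕ} (Γ : Subgroup (Aff n)) : Type := MulAction.orbitRel.Quotient Γ (E n)

/-- The orbit `Γ x`. -/
abbrev orb {n : ℕ} (Γ : Subgroup (Aff n)) (x : E n) : Orb Γ := Quotient.mk _ x

theorem orb_eq_iff {n : ℕ} {Γ : Subgroup (Aff n)} {x y : E n} :
    orb Γ x = orb Γ y ↔ ∃ γ ∈ Γ, γ y = x := by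
  rw [Quotient.eq]
  constructor
  · rintro ⟨γ, h⟩
    exact ⟨γ.1, γ.2, h⟩
  · rintro ⟨γ, hγ, h⟩
    exact ⟨⟨γ, hγ⟩, h⟩

/-- An `n`-space group: a discrete group of isometries of `Eⁿ` (with respect to the compact-open
topology) whose orbit space is compact. -/
structure IsSpaceGroup {n : ℕ} (Γ : Subgroup (Aff n)) : Prop where
  isometry : ∀ γ ∈ Γ, Isometry γ
  discrete : IsDiscrete (toC '' (Γ : Set (Aff n)))
  compact : CompactSpace (Orb Γ)

theorem toC_injective {n : ℕ} : Function.Injective (toC (n := n)) := by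
  intro g h hgh
  ext1 x
  exact congrArg (fun f : C(E n, E n) => f x) hgh

theorem IsSpaceGroup.countable {n : ℕ} {Γ : Subgroup (Aff n)} (h : IsSpaceGroup Γ) :
    Countable Γ := by
  have := h.discrete.to_subtype
  have hc : Countable (toC '' (Γ : Set (Aff n))) :=
    TopologicalSpace.separableSpace_iff_countable.1 inferInstance
  have : (toC '' (Γ : Set (Aff n))).Countable := hc
  exact (Set.countable_of_injective_of_countable_image toC_injective.injOn this).to_subtype

theorem IsSpaceGroup.exists_eq_mul {n : ℕ} {Γ : Subgroup (Aff n)} (hΓ : IsSpaceGroup Γ)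
    {g h : Aff n} (H : ∀ x, orb Γ (g x) = orb Γ (h x)) : ∃ γ ∈ Γ, g = γ * h := by
  have := hΓ.countable
  have hc : ∀ γ : Γ, IsClosed {x : E n | g x = (γ.1 * h) x} := fun γ =>
    isClosed_eq (toC g).continuous (toC (γ.1 * h)).continuous
  obtain ⟨γ, hγ⟩ := nonempty_interior_of_iUnion_of_closed hc (by
    refine Set.eq_univ_of_forall fun x => Set.mem_iUnion.2 ?_
    obtain ⟨γ, hγ, e⟩ := orb_eq_iff.1 (H x)
    exact ⟨⟨γ, hγ⟩, e.symm⟩)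
  refine ⟨γ.1, γ.2, ?_⟩
  have ht := affineSpan_eq_top_of_nonempty_interior
    (s := {x : E n | g x = (γ.1 * h) x}) (hγ.mono (interior_mono (subset_convexHull ℝ _)))
  have := AffineMap.ext_on (f := (g : E n →ᵃ[ℝ] E n)) (g := ((γ.1 * h : Aff n) : E n →ᵃ[ℝ] E n))
    ht (fun x hx => hx)
  exact AffineEquiv.toAffineMap_injective this

/-! ### Affinities and isometries of an orbit space -/

/-- The affinity `g` of `Eⁿ` is a lift of the self-map `β` of `Eⁿ/Γ`. -/
def IsLift {n : ℕ} {Γ : Subgroup (Aff n)} (β : Equiv.Perm (Orb Γ)) (g : Aff n) : Prop :=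
  ∀ x, β (orb Γ x) = orb Γ (g x)

theorem IsLift.mul {n : ℕ} {Γ : Subgroup (Aff n)} {β β' : Equiv.Perm (Orb Γ)} {g g' : Aff n}
    (h : IsLift β g) (h' : IsLift β' g') : IsLift (β * β') (g * g') := fun x => by
  rw [Equiv.Perm.mul_apply, h' x, h (g' x)]
  rfl

theorem IsLift.inv {n : ℕ} {Γ : Subgroup (Aff n)} {β : Equiv.Perm (Orb Γ)} {g : Aff n}
    (h : IsLift β g) : IsLift β⁻¹ g⁻¹ := fun x => by
  rw [Equiv.Perm.inv_eq_iff_eq, h]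
  exact congrArg _ (g.apply_symm_apply x).symm

/-- The group `Aff(Eⁿ/Γ)` of affinities of `Eⁿ/Γ`: the bijections of `Eⁿ/Γ` that lift to an
affinity of `Eⁿ`. -/
def affOrb {n : ℕ} (Γ : Subgroup (Aff n)) : Subgroup (Equiv.Perm (Orb Γ)) where
  carrier := {β | ∃ g : Aff n, IsLift β g}
  one_mem' := ⟨1, fun _ => rfl⟩
  mul_mem' := by
    rintro _ _ ⟨g, hg⟩ ⟨g', hg'⟩
    exact ⟨g * g', hg.mul hg'⟩
  inv_mem' := by
    rintro _ ⟨g, hg⟩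
    exact ⟨g⁻¹, hg.inv⟩

/-- The orbit space distance: `d(p, q)` is the distance in `Eⁿ` between the orbits `p` and `q`. -/
def orbDist {n : ℕ} {Γ : Subgroup (Aff n)} (p q : Orb Γ) : ℝ :=
  sInf {r | ∃ x y, orb Γ x = p ∧ orb Γ y = q ∧ r = dist x y}

/-- The group `Isom(Eⁿ/Γ)` of isometries of `Eⁿ/Γ`. -/
def isomOrb {n : ℕ} (Γ : Subgroup (Aff n)) : Subgroup (Equiv.Perm (Orb Γ)) where
  carrier := {β | ∀ p q, orbDist (β p) (β q) = orbDist p q}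
  one_mem' := fun _ _ => rfl
  mul_mem' := by
    intro β β' h h' p q
    rw [Equiv.Perm.mul_apply, Equiv.Perm.mul_apply, h, h']
  inv_mem' := by
    intro β h p q
    have := h (β⁻¹ p) (β⁻¹ q)
    simpa using this.symm

theorem IsLift.conj_mem {n : ℕ} {Γ : Subgroup (Aff n)} (hΓ : IsSpaceGroup Γ)
    {β : Equiv.Perm (Orb Γ)} {g : Aff n} (h : IsLift β g) {γ : Aff n} (hγ : γ ∈ Γ) :
    g * γ * g⁻¹ ∈ Γ := by
  obtain ⟨γ', hγ', e⟩ := hΓ.exists_eq_mul (g := g * γ) (h := g) (fun x => by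
    have h1 : orb Γ (γ x) = orb Γ x := orb_eq_iff.2 ⟨γ, hγ, rfl⟩
    change orb Γ (g (γ x)) = orb Γ (g x)
    rw [← h, ← h, h1])
  rw [e, mul_inv_cancel_right]
  exact hγ'

theorem IsLift.mem_normalizer {n : ℕ} {Γ : Subgroup (Aff n)} (hΓ : IsSpaceGroup Γ)
    {β : Equiv.Perm (Orb Γ)} {g : Aff n} (h : IsLift β g) :
    g ∈ Subgroup.normalizer (Γ : Set (Aff n)) := by
  rw [Subgroup.mem_normalizer_iff]
  refine fun γ => ⟨fun hγ => h.conj_mem hΓ hγ, fun hγ => ?_⟩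
  have := h.inv.conj_mem hΓ hγ
  simpa [mul_assoc] using this

/-- The class in `Out(Γ)` of the automorphism `γ ↦ g γ g⁻¹` of `Γ`, for `g` in the normalizer of
`Γ` in the group of affinities of `Eⁿ`. -/
def normOut {n : ℕ} (Γ : Subgroup (Aff n)) :
    Subgroup.normalizer (Γ : Set (Aff n)) →* Out Γ :=
  (QuotientGroup.mk' (inner Γ)).comp Γ.normalizerMonoidHom

theorem normOut_eq_of_isLift {n : ℕ} {Γ : Subgroup (Aff n)} (hΓ : IsSpaceGroup Γ)
    {β : Equiv.Perm (Orb Γ)} {g g' : Aff n} (h : IsLift β g) (h' : IsLift β g') :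
    normOut Γ ⟨g, h.mem_normalizer hΓ⟩ = normOut Γ ⟨g', h'.mem_normalizer hΓ⟩ := by
  obtain ⟨γ, hγ, rfl⟩ := hΓ.exists_eq_mul (g := g) (h := g') (fun x => by rw [← h, ← h'])
  have hn : γ ∈ Subgroup.normalizer (Γ : Set (Aff n)) := Subgroup.le_normalizer hγ
  have e : (⟨γ * g', h.mem_normalizer hΓ⟩ : Subgroup.normalizer (Γ : Set (Aff n))) =
      ⟨γ, hn⟩ * ⟨g', h'.mem_normalizer hΓ⟩ := rfl
  rw [e, map_mul]
  have : normOut Γ ⟨γ, hn⟩ = 1 := by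
    refine (QuotientGroup.eq_one_iff _).2 ⟨⟨γ, hγ⟩, ?_⟩
    ext x
    rfl
  rw [this, one_mul]

/-- The homomorphism `Ω : Aff(Eⁿ/Γ) → Out(Γ)`, sending `β` to the class of conjugation by any
lift of `β` to an affinity of `Eⁿ`. -/
def Omega {n : ℕ} {Γ : Subgroup (Aff n)} (hΓ : IsSpaceGroup Γ) : affOrb Γ →* Out Γ where
  toFun β := normOut Γ ⟨β.2.choose, β.2.choose_spec.mem_normalizer hΓ⟩
  map_one' := by
    rw [normOut_eq_of_isLift hΓ (1 : affOrb Γ).2.choose_spec (g' := 1) (fun _ => rfl)]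
    exact map_one _
  map_mul' β β' := by
    rw [normOut_eq_of_isLift hΓ (β * β').2.choose_spec
      (β.2.choose_spec.mul β'.2.choose_spec), ← map_mul]
    rfl

theorem Omega_apply {n : ℕ} {Γ : Subgroup (Aff n)} (hΓ : IsSpaceGroup Γ) (β : affOrb Γ)
    {g : Aff n} (h : IsLift β.1 g) :
    Omega hΓ β = normOut Γ ⟨g, h.mem_normalizer hΓ⟩ :=
  normOut_eq_of_isLift hΓ β.2.choose_spec h

/-- The conjugate `φ Γ φ⁻¹`. -/
def conj {n : ℕ} (φ : Aff n) (Γ : Subgroup (Aff n)) : Subgroup (Aff n) :=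
  Γ.map (MulAut.conj φ).toMonoidHom

/-- The map `φ_⋆ : Eⁿ/Γ → Eⁿ/φΓφ⁻¹`, `Γ x ↦ φΓφ⁻¹ φ(x)`. -/
def star {n : ℕ} (φ : Aff n) (Γ : Subgroup (Aff n)) : Orb Γ ≃ Orb (conj φ Γ) :=
  Quotient.congr φ.toEquiv (by
    intro x y
    constructor
    · rintro ⟨γ, rfl⟩
      refine ⟨⟨MulAut.conj φ γ.1, ⟨γ.1, γ.2, rfl⟩⟩, ?_⟩
      change φ (γ.1 (φ.symm (φ y))) = φ (γ.1 y)
      rw [AffineEquiv.symm_apply_apply]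
    · rintro ⟨⟨_, ⟨γ, hγ, rfl⟩⟩, h⟩
      refine ⟨⟨γ, hγ⟩, ?_⟩
      change φ (γ (φ.symm (φ y))) = φ x at h
      rw [AffineEquiv.symm_apply_apply] at h
      exact φ.injective h)

theorem star_orb {n : ℕ} (φ : Aff n) (Γ : Subgroup (Aff n)) (x : E n) :
    star φ Γ (orb Γ x) = orb (conj φ Γ) (φ x) := rfl

/-- `φ_♯ β = φ_⋆ β φ_⋆⁻¹`, transporting self-maps of `Eⁿ/Γ` to self-maps of `Eⁿ/φΓφ⁻¹`. -/
def sharp {n : ℕ} (φ : Aff n) (Γ : Subgroup (Aff n)) (β : Equiv.Perm (Orb Γ)) :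
    Equiv.Perm (Orb (conj φ Γ)) :=
  ((star φ Γ).symm.trans β).trans (star φ Γ)

/-! ### Complete normal subgroups -/

/-- `Span(N)`, the linear span of all `a` such that the translation `a + I` belongs to `N`. -/
def spanOf {n : ℕ} {Γ : Subgroup (Aff n)} (N : Subgroup Γ) : Submodule ℝ (E n) :=
  Submodule.span ℝ {a | ∃ ν ∈ N, (ν : Aff n) = AffineEquiv.constVAdd ℝ (E n) a}

/-- With `V = Span(N)`, the subgroup `N` of `Γ` consists of all `a + A ∈ Γ` such that `a ∈ V` and
`A` fixes the orthogonal complement of `V` pointwise. -/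
def IsComplete {n : ℕ} {Γ : Subgroup (Aff n)} (N : Subgroup Γ) : Prop :=
  ∀ γ : Γ, γ ∈ N ↔
    γ.1 0 ∈ spanOf N ∧ ∀ w ∈ (spanOf N)ᗮ, γ.1.linear w = w

/-! ### The set `Iso(Δ, M)` -/

section Sets

variable {m k : ℕ} (Δ : Subgroup (Aff k)) (M : Subgroup (Aff m))

/-- A pair `(Γ, N)`, where `N` is a complete normal subgroup of an `(m + k)`-space group `Γ` such
that `N` is isomorphic to `M` and `Γ/N` is isomorphic to `Δ`. -/
structure Pair where
  Γ : Subgroup (Aff (m + k))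
  spaceGroup : IsSpaceGroup Γ
  N : Subgroup Γ
  normal : N.Normal
  complete : IsComplete N
  isoM : Nonempty (N ≃* M)
  isoΔ : Nonempty (Γ ⧸ N ≃* Δ)

attribute [instance] Pair.normal

variable {Δ M} in
/-- Two pairs are isomorphic if there is a group isomorphism `Γ₁ → Γ₂` mapping `N₁` onto `N₂`. -/
def Pair.Iso (p q : Pair Δ M) : Prop :=
  ∃ φ : p.Γ ≃* q.Γ, p.N.map φ.toMonoidHom = q.N

/-- Isomorphism of pairs as an equivalence relation. -/
instance pairSetoid : Setoid (Pair Δ M) where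
  r := Pair.Iso
  iseqv := by
    refine ⟨fun p => ⟨MulEquiv.refl _, Subgroup.map_id _⟩, ?_, ?_⟩
    · rintro p q ⟨φ, h⟩
      refine ⟨φ.symm, ?_⟩
      rw [← h, Subgroup.map_map]
      convert! Subgroup.map_id p.N
      ext x
      simp
    · rintro p q r ⟨φ, h⟩ ⟨χ, h'⟩
      refine ⟨φ.trans χ, ?_⟩
      rw [← h', ← h, Subgroup.map_map]
      rfl

/-- The set `Iso(Δ, M)` of isomorphism classes of pairs. -/
def IsoSet : Type := Quotient (pairSetoid Δ M)

variable {Δ M} in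
/-- The isomorphism class `[Γ, N]`. -/
def Pair.cls (p : Pair Δ M) : IsoSet Δ M := Quotient.mk _ p

/-! ### The sets `Aff(Δ, M)` and `Out(Δ, M)` -/

/-- Two homomorphisms `η₁, η₂ : D → A` into a group `A` lie in the same orbit under conjugation by
elements of `A` and precomposition with automorphisms of `D`. Inner automorphisms of `D` do not
change the conjugation orbit of a homomorphism, so the orbits under `Aut(D)` on the conjugation
orbits are the orbits under `Out(D)`. -/
def SameOrbit {D A : Type*} [Group D] [Group A] (η₁ η₂ : D →* A) : Prop :=
  ∃ (a : A) (ζ : MulAut D), ∀ δ, η₂ δ = a * η₁ (ζ δ) * a⁻¹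

theorem sameOrbit_equivalence {D A : Type*} [Group D] [Group A] :
    Equivalence (SameOrbit (D := D) (A := A)) := by
  refine ⟨fun η => ⟨1, 1, by simp⟩, ?_, ?_⟩
  · rintro η₁ η₂ ⟨a, ζ, h⟩
    refine ⟨a⁻¹, ζ⁻¹, fun δ => ?_⟩
    rw [h, MulAut.apply_inv_self]
    group
  · rintro η₁ η₂ η₃ ⟨a, ζ, h⟩ ⟨b, ξ, h'⟩
    refine ⟨b * a, ζ * ξ, fun δ => ?_⟩
    rw [h', h, MulAut.mul_apply]
    group

variable {M} in
/-- `Hom_f(Δ, Aff(M))`: the homomorphisms `η : Δ → Aff(Eᵐ/M)` such that `Ω η` has finite image. -/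
def HomAff (hM : IsSpaceGroup M) : Type :=
  {η : Δ →* affOrb M // (Set.range ((Omega hM).comp η)).Finite}

/-- `Hom_f(Δ, Out(M))`: the homomorphisms `Δ → Out(M)` with finite image. -/
def HomOut : Type := {η : Δ →* Out M // (Set.range η).Finite}

/-- The orbit relation on `Hom_f(Δ, Aff(M))` for conjugation by `Aff(M)` and `Out(Δ)`. -/
def affSetoid {M : Subgroup (Aff m)} (hM : IsSpaceGroup M) : Setoid (HomAff Δ hM) where
  r η₁ η₂ := SameOrbit η₁.1 η₂.1
  iseqv := ⟨fun η => sameOrbit_equivalence.refl η.1, sameOrbit_equivalence.symm,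
    sameOrbit_equivalence.trans⟩

/-- The orbit relation on `Hom_f(Δ, Out(M))` for conjugation by `Out(M)` and `Out(Δ)`. -/
def outSetoid : Setoid (HomOut Δ M) where
  r η₁ η₂ := SameOrbit η₁.1 η₂.1
  iseqv := ⟨fun η => sameOrbit_equivalence.refl η.1, sameOrbit_equivalence.symm,
    sameOrbit_equivalence.trans⟩

/-- The set `Aff(Δ, M) = (Aff(M) \ Hom_f(Δ, Aff(M))) / Out(Δ)`. -/
def AffSet {M : Subgroup (Aff m)} (hM : IsSpaceGroup M) : Type := Quotient (affSetoid Δ hM)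

/-- The set `Out(Δ, M) = (Out(M) \ Hom_f(Δ, Out(M))) / Out(Δ)`. -/
def OutSet : Type := Quotient (outSetoid Δ M)

variable {Δ M} in
/-- The class `[η]` in `Aff(Δ, M)`. -/
def HomAff.cls {hM : IsSpaceGroup M} (η : HomAff Δ hM) : AffSet Δ hM :=
  Quotient.mk (affSetoid Δ hM) η

variable {Δ M} in
/-- The class `[η]` in `Out(Δ, M)`. -/
def HomOut.cls (η : HomOut Δ M) : OutSet Δ M := Quotient.mk (outSetoid Δ M) η

/-! ### The construction of `(Γ, N)` from `η` -/

/-- The affinity `α × δ` of `E^(m+k) = Eᵐ × Eᵏ`. -/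
def prodAff {m k : ℕ} (α : Aff m) (δ : Aff k) : Aff (m + k) :=
  let e : E (m + k) ≃ᵃ[ℝ] E m × E k :=
    (EuclideanSpace.finAddEquivProd (𝕜 := ℝ) (n := m) (m := k)).toLinearEquiv.toAffineEquiv
  (e.trans (α.prodCongr δ)).trans e.symm

variable {Δ M} in
/-- The pair `p = (Γ, N)` arises from `η` by means of the linear automorphism `C` of `Eᵐ`:
* `C M C⁻¹` is a space group and `C_♯ η` takes values in `Isom(Eᵐ/C M C⁻¹)`;
* `N` is the extension of `C M C⁻¹` acting trivially on the factor `Eᵏ` of `E^(m+k) = Eᵐ × Eᵏ`;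
* every `γ ∈ Γ` is a product `γ̄ × γ'` of affinities of `Eᵐ` and `Eᵏ`;
* the group `Γ'` of all the `γ'` is `Δ`;
* the action of `Γ/N` on `Eᵐ/C M C⁻¹`, `Nγ ↦ γ̄_⋆`, is `C_♯ η` composed with `Nγ ↦ γ'`. -/
structure ArisesVia (η : Δ →* affOrb M) (p : Pair Δ M) (C : E m ≃ₗ[ℝ] E m) : Prop where
  spaceGroup : IsSpaceGroup (conj C.toAffineEquiv M)
  isometric : ∀ δ, sharp C.toAffineEquiv M (η δ).1 ∈ isomOrb (conj C.toAffineEquiv M)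
  extension : ∀ γ : Aff (m + k), (∃ h : γ ∈ p.Γ, (⟨γ, h⟩ : p.Γ) ∈ p.N) ↔
    ∃ μ ∈ conj C.toAffineEquiv M, γ = prodAff μ 1
  splits : ∀ γ ∈ p.Γ, ∃ (α : Aff m) (δ : Aff k), γ = prodAff α δ
  base : ∀ δ : Aff k, δ ∈ Δ ↔ ∃ α : Aff m, prodAff α δ ∈ p.Γ
  action : ∀ (α : Aff m) (δ : Δ), prodAff α δ.1 ∈ p.Γ → ∀ x,
    sharp C.toAffineEquiv M (η δ).1 (orb _ x) = orb (conj C.toAffineEquiv M) (α x)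

variable {Δ M} in
/-- The pair `p` arises from `η` by the construction above for some `C ∈ GL(m, ℝ)`. -/
def Arises (η : Δ →* affOrb M) (p : Pair Δ M) : Prop :=
  ∃ C : E m ≃ₗ[ℝ] E m, ArisesVia η p C

/-- `ψ : Aff(Δ, M) → Iso(Δ, M)` is the map `[η] ↦ [Γ, N]`: every `η` gives rise to some pair
`(Γ, N)`, and `ψ` maps `[η]` to `[Γ, N]` for every pair `(Γ, N)` to which `η` gives rise. -/
def IsPsi {M : Subgroup (Aff m)} (hM : IsSpaceGroup M) (ψ : AffSet Δ hM → IsoSet Δ M) : Prop :=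
  ∀ η : HomAff Δ hM, (∃ p : Pair Δ M, Arises η.1 p) ∧
    ∀ p : Pair Δ M, Arises η.1 p → ψ η.cls = p.cls

/-- `ω : Iso(Δ, M) → Out(Δ, M)` is the map `[Γ, N] ↦ [α_# 𝒪 β]`: for every pair `(Γ, N)` and all
isomorphisms `α : N → M` and `β : Δ → Γ/N`, the homomorphism `α_# 𝒪 β : Δ → Out(M)` has finite
image, and `ω` maps `[Γ, N]` to its class. -/
def IsOmega (ω : IsoSet Δ M → OutSet Δ M) : Prop :=
  ∀ (p : Pair Δ M) (α : p.N ≃* M) (β : Δ ≃* p.Γ ⧸ p.N),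
    ∃ h : (Set.range
        (((outCongr α).toMonoidHom.comp (conjOut p.N)).comp β.toMonoidHom)).Finite,
      ω p.cls = HomOut.cls ⟨((outCongr α).toMonoidHom.comp (conjOut p.N)).comp β.toMonoidHom, h⟩

end Sets

end FlatOrbifold

end

/-! The homomorphism `Omega` induces a map `omegaComp` from `AffSet` to `OutSet`, and everything
rests on the triangle ω ∘ ψ = `omegaComp`, which is `Arises.exists_outHom_eq`: conjugation of `N` by
an element of `Γ` over `δ` is, up to `C`, conjugation of `M` by a lift of `η δ`.

For centerless `M`, `Omega` is an isomorphism. It is onto because every automorphism of a space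
group is conjugation by an affinity (`IsSpaceGroup.exists_conj_eq`, Bieberbach's second theorem),
and injective because the affine centralizer of `M` is trivial. Hence `omegaComp` is bijective.
Next, ω is injective, since an extension of a centerless group is determined by its outer action
(`exists_equiv_of_conjOut`), and surjective, since every `η` arises from a pair (`exists_arises`).
So ψ is the inverse of ω composed with `omegaComp`.

The geometric input is Bieberbach's first theorem: elements with rotation close to 1 are
translations (`IsSpaceGroup.lin_eq_one_of_norm_sub_one_le`, by a commutator argument on shortest
elements), so the translations form a lattice and the point group is finite. These facts give the
linear extension of automorphisms, the averaging arguments, and the finiteness of the outer action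
on a normal subgroup (`IsSpaceGroup.finite_range_conjOut`), which makes ω well defined. -/

noncomputable section

namespace FlatOrbifold

/-! ### Affinities, their linear parts and translations -/

section Basics

variable {n : ℕ}

/-- The linear part of an affinity, as a continuous linear map. -/
def lin (n : ℕ) : Aff n →* (E n →L[ℝ] E n) where
  toFun g := LinearMap.toContinuousLinearMap (g.linear : E n →ₗ[ℝ] E n)
  map_one' := rfl
  map_mul' _ _ := rfl

theorem lin_apply (g : Aff n) (x : E n) : lin n g x = g.linear x := rfl

theorem aff_apply (g : Aff n) (x : E n) : g x = lin n g x + g 0 := by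
  have := g.map_vadd 0 x
  simpa [lin_apply] using this

theorem aff_mul_apply (g h : Aff n) (x : E n) : (g * h) x = g (h x) := rfl

theorem aff_inv_apply_self (g : Aff n) (x : E n) : g⁻¹ (g x) = x := g.symm_apply_apply x

theorem aff_apply_inv_self (g : Aff n) (x : E n) : g (g⁻¹ x) = x := g.apply_symm_apply x

theorem lin_mul_apply (g h : Aff n) (x : E n) : lin n (g * h) x = lin n g (lin n h x) := rfl

theorem lin_apply_inv_self (g : Aff n) (x : E n) : lin n g (lin n g⁻¹ x) = x := by
  rw [← lin_mul_apply, mul_inv_cancel, map_one]; rfl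

theorem aff_ext {g h : Aff n} (h1 : lin n g = lin n h) (h0 : g 0 = h 0) : g = h := by
  ext1 x
  rw [aff_apply g, aff_apply h, h1, h0]

/-- The translation by `v`. -/
abbrev transl (v : E n) : Aff n := AffineEquiv.constVAdd ℝ (E n) v

theorem transl_apply (v x : E n) : transl v x = v + x := rfl

theorem transl_zero : transl (0 : E n) = 1 := by
  ext1 x
  exact zero_add x

theorem lin_transl (v : E n) : lin n (transl v) = 1 := rfl

theorem transl_mul (v w : E n) : transl v * transl w = transl (v + w) := by
  ext1 x
  simp [aff_mul_apply]

theorem transl_inv (v : E n) : (transl v)⁻¹ = transl (-v) := by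
  rw [inv_eq_iff_mul_eq_one, transl_mul, add_neg_cancel, transl_zero]

theorem transl_injective : Function.Injective (transl (n := n)) := fun v w h => by
  have := congrArg (fun g : Aff n => g 0) h
  simpa using this

theorem eq_transl_of_lin_eq_one {g : Aff n} (h : lin n g = 1) : g = transl (g 0) :=
  aff_ext h (by simp)

theorem conj_transl (g : Aff n) (v : E n) : g * transl v * g⁻¹ = transl (lin n g v) := by
  rw [mul_inv_eq_iff_eq_mul]
  ext1 x
  rw [aff_mul_apply, aff_mul_apply, transl_apply, transl_apply, aff_apply g, aff_apply g x,
    map_add, add_assoc]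

theorem linearHom_eq_one_iff {g : Aff n} : AffineEquiv.linearHom g = 1 ↔ lin n g = 1 := by
  constructor
  · intro h
    ext1 x
    exact LinearEquiv.congr_fun h x
  · intro h
    ext1 x
    exact DFunLike.congr_fun h x

theorem norm_lin_apply {g : Aff n} (hg : Isometry g) (x : E n) : ‖lin n g x‖ = ‖x‖ := by
  have h := hg.dist_eq x 0
  rwa [aff_apply g x, dist_eq_norm, add_sub_cancel_right, dist_zero_right] at h

theorem isometry_of_norm_lin {g : Aff n} (h : ∀ x, ‖lin n g x‖ = ‖x‖) : Isometry g := by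
  refine Isometry.of_dist_eq fun x y => ?_
  rw [aff_apply g x, aff_apply g y, dist_add_right, dist_eq_norm, ← map_sub, h, dist_eq_norm]

theorem norm_lin_le_one {g : Aff n} (hg : Isometry g) : ‖lin n g‖ ≤ 1 :=
  ContinuousLinearMap.opNorm_le_bound _ zero_le_one fun x => by rw [norm_lin_apply hg, one_mul]

theorem norm_mul_lin_le {g : Aff n} (hg : Isometry g) (L : E n →L[ℝ] E n) :
    ‖L * lin n g‖ ≤ ‖L‖ :=
  (norm_mul_le _ _).trans (mul_le_of_le_one_right (norm_nonneg _) (norm_lin_le_one hg))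

theorem norm_lin_mul_le {g : Aff n} (hg : Isometry g) (L : E n →L[ℝ] E n) :
    ‖lin n g * L‖ ≤ ‖L‖ :=
  (norm_mul_le _ _).trans (mul_le_of_le_one_left (norm_nonneg _) (norm_lin_le_one hg))

theorem norm_apply_sub_le {g : Aff n} (hg : Isometry g) (x : E n) : ‖g x - g 0‖ ≤ ‖x‖ := by
  rw [aff_apply g x, add_sub_cancel_right, norm_lin_apply hg]

theorem isometry_mul {g h : Aff n} (hg : Isometry g) (hh : Isometry h) :
    Isometry (g * h : Aff n) := hg.comp hh

theorem isometry_inv {g : Aff n} (hg : Isometry g) : Isometry (g⁻¹ : Aff n) :=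
  hg.right_inv g.apply_symm_apply

theorem norm_inv_zero {g : Aff n} (hg : Isometry g) : ‖g⁻¹ 0‖ = ‖g 0‖ := by
  have h := hg.dist_eq (g⁻¹ 0) 0
  rw [aff_apply_inv_self, dist_zero_left, dist_zero_right] at h
  exact h.symm

end Basics

/-! ### Space groups in terms of norms -/

section Discrete

variable {n : ℕ} {Γ : Subgroup (Aff n)}

/-- A discrete group of isometries has no nontrivial elements close to the identity. -/
theorem IsSpaceGroup.exists_pos_eq_one (hΓ : IsSpaceGroup Γ) :
    ∃ ε > 0, ∀ γ ∈ Γ, ‖γ 0‖ < ε → ‖lin n γ - 1‖ < ε → γ = 1 := by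
  obtain ⟨U, hU, hUe⟩ := isDiscrete_iff_forall_mem_exists_isOpen.1 hΓ.discrete (toC (1 : Aff n))
    ⟨1, Γ.one_mem, rfl⟩
  have h1 : toC (1 : Aff n) ∈ U := by
    have : toC (1 : Aff n) ∈ ({toC (1 : Aff n)} : Set _) := rfl
    rw [← hUe] at this
    exact this.1
  -- In the compact-open topology an affine map depends continuously on its translation and linear
  -- parts, so `U` contains every affine map whose parts are close to `(0, 1)`.
  have hev : ∀ᶠ p : E n × (E n →L[ℝ] E n) in nhds (0, 1),
      (ContinuousMap.const (E n) p.1 + (p.2 : C(E n, E n))) ∈ U := by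
    have hc : Continuous fun p : E n × (E n →L[ℝ] E n) =>
        (ContinuousMap.const (E n) p.1 + (p.2 : C(E n, E n))) := by
      refine ContinuousMap.continuous_of_continuous_uncurry _ ?_
      change Continuous fun q : (E n × (E n →L[ℝ] E n)) × E n => q.1.1 + q.1.2 q.2
      fun_prop
    refine hc.continuousAt.eventually_mem (hU.mem_nhds ?_)
    convert! h1
    ext1 x
    simp [toC]
  obtain ⟨ε, hε, hb⟩ := Metric.eventually_nhds_iff.1 hev
  refine ⟨ε, hε, fun γ hγ h0 h1' => ?_⟩
  have hm := hb (y := (γ 0, lin n γ)) (by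
    rw [Prod.dist_eq, max_lt_iff, dist_zero_right, dist_eq_norm]
    exact ⟨h0, h1'⟩)
  have he : (ContinuousMap.const (E n) (γ 0) + (lin n γ : C(E n, E n))) = toC γ := by
    ext1 x
    change γ 0 + lin n γ x = γ x
    rw [aff_apply γ x, add_comm]
  rw [he] at hm
  have : toC γ ∈ ({toC (1 : Aff n)} : Set _) := by
    rw [← hUe]
    exact ⟨hm, γ, hγ, rfl⟩
  exact toC_injective this

theorem finite_of_separated {ι X : Type*} [PseudoMetricSpace X] [ProperSpace X] {f : ι → X} {a : X}
    {r ε : ℝ} (hf : ∀ i, f i ∈ Metric.closedBall a r) (hε : 0 < ε)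
    (h : ∀ i j, dist (f i) (f j) < ε → i = j) : Finite ι := by
  by_contra hinf
  rw [not_finite_iff_infinite] at hinf
  let s := Infinite.natEmbedding ι
  obtain ⟨b, -, φ, hφ, hlim⟩ :=
    (isCompact_closedBall a r).tendsto_subseq (x := f ∘ s) (fun i => hf (s i))
  obtain ⟨N, hN⟩ := Metric.cauchySeq_iff'.1 hlim.cauchySeq ε hε
  exact N.lt_succ_self.ne' (hφ.injective (s.injective (h _ _ (hN (N + 1) N.le_succ))))

/-- The pairs (translation part, linear part) lie in a compact ball, and they are separated because
`g'⁻¹ * g` is as close to 1 as `g` is to `g'`. -/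
theorem IsSpaceGroup.finite_norm_le (hΓ : IsSpaceGroup Γ) (R : ℝ) :
    {γ | γ ∈ Γ ∧ ‖γ 0‖ ≤ R}.Finite := by
  obtain ⟨ε, hε, h⟩ := hΓ.exists_pos_eq_one
  refine finite_of_separated (a := (0 : E n × (E n →L[ℝ] E n))) (r := max R 1) (ε := ε)
    (f := fun γ : {γ | γ ∈ Γ ∧ ‖γ 0‖ ≤ R} => (γ.1 0, lin n γ.1)) ?_ hε ?_
  · rintro ⟨γ, hγ, hR⟩
    rw [mem_closedBall_zero_iff, Prod.norm_def]
    exact max_le_max hR (norm_lin_le_one (hΓ.isometry _ hγ))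
  · rintro ⟨g, hg, _⟩ ⟨g', hg', _⟩ hd
    have hiso' := hΓ.isometry _ hg'
    rw [Prod.dist_eq, max_lt_iff, dist_eq_norm, dist_eq_norm] at hd
    refine Subtype.ext (eq_of_inv_mul_eq_one (a := g') (b := g) ?_).symm
    refine h _ (Γ.mul_mem (Γ.inv_mem hg') hg) ?_ ?_
    · have := hiso'.dist_eq ((g'⁻¹ * g) 0) 0
      rw [aff_mul_apply, aff_apply_inv_self, dist_zero_right, dist_eq_norm] at this
      rw [aff_mul_apply, ← this]
      exact hd.1
    · have e : lin n (g'⁻¹ * g) - 1 = lin n g'⁻¹ * (lin n g - lin n g') := by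
        rw [mul_sub, ← map_mul, ← map_mul, inv_mul_cancel, map_one]
      rw [e]
      exact (norm_lin_mul_le (isometry_inv hiso') _).trans_lt hd.2

/-- The images of the balls of integer radius form an increasing open cover of the compact orbit
space. -/
theorem IsSpaceGroup.exists_norm_le (hΓ : IsSpaceGroup Γ) : ∃ R, ∀ x, ∃ γ ∈ Γ, ‖γ x‖ ≤ R := by
  have := hΓ.compact
  let U : ℕ → Set (Orb Γ) := fun i => (fun x => orb Γ x) '' Metric.ball (0 : E n) i
  have hU : ∀ i, IsOpen (U i) := fun i => by
    rw [isOpen_coinduced]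
    have : (fun x => orb Γ x) ⁻¹' U i = ⋃ γ : Γ, (fun x => γ.1 x) ⁻¹' Metric.ball (0 : E n) i := by
      ext x
      simp only [U, Set.mem_preimage, Set.mem_image, Set.mem_iUnion]
      constructor
      · rintro ⟨y, hy, e⟩
        obtain ⟨γ, hγ, e⟩ := orb_eq_iff.1 e
        exact ⟨⟨γ, hγ⟩, by rwa [e]⟩
      · rintro ⟨γ, h⟩
        exact ⟨_, h, orb_eq_iff.2 ⟨γ.1, γ.2, rfl⟩⟩
    refine this ▸ isOpen_iUnion fun γ => Metric.isOpen_ball.preimage (toC γ.1).continuous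
  obtain ⟨N, hN⟩ := (isCompact_univ (X := Orb Γ)).elim_directed_cover U hU (by
    intro p _
    induction p using Quotient.inductionOn with
    | h x =>
      obtain ⟨i, hi⟩ := exists_nat_gt ‖x‖
      exact Set.mem_iUnion.2 ⟨i, x, by simpa using hi, rfl⟩)
    (Monotone.directed_le fun i j h => Set.image_mono (Metric.ball_subset_ball (by exact_mod_cast h)))
  refine ⟨N, fun x => ?_⟩
  obtain ⟨y, hy, e⟩ := hN (Set.mem_univ (orb Γ x))
  obtain ⟨γ, hγ, e⟩ := orb_eq_iff.1 e
  refine ⟨γ, hγ, ?_⟩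
  rw [e]
  exact (mem_ball_zero_iff.1 hy).le

/-- Converse to the two preceding estimates; it is the criterion by which conjugates of `M` and the
constructed group `Γ` are recognized as space groups. -/
theorem IsSpaceGroup.of_norm (h1 : ∀ γ ∈ Γ, Isometry γ)
    (h2 : ∀ R : ℝ, {γ | γ ∈ Γ ∧ ‖γ 0‖ ≤ R}.Finite) (h3 : ∃ R, ∀ x, ∃ γ ∈ Γ, ‖γ x‖ ≤ R) :
    IsSpaceGroup Γ := by
  refine ⟨h1, ?_, ?_⟩
  · rw [isDiscrete_iff_forall_mem_exists_isOpen]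
    rintro _ ⟨γ, hγ, rfl⟩
    let F : Set C(E n, E n) := toC '' ({g | g ∈ Γ ∧ ‖g 0‖ ≤ ‖γ 0‖ + 1} \ {γ})
    have hF : F.Finite := ((h2 _).subset Set.sdiff_subset).image _
    have hmem : toC γ ∉ F := by
      rintro ⟨g, ⟨-, hg⟩, e⟩
      exact hg (toC_injective e)
    refine ⟨{f | ‖f 0‖ < ‖γ 0‖ + 1} ∩ Fᶜ, ?_, ?_⟩
    · refine IsOpen.inter ?_ hF.isClosed.isOpen_compl
      exact isOpen_lt (continuous_norm.comp (continuous_eval_const 0))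
        continuous_const
    · ext f
      constructor
      · intro hf
        obtain ⟨⟨h, h'⟩, ⟨g, hg, rfl⟩⟩ : f ∈ ({f : C(E n, E n) | ‖f 0‖ < ‖γ 0‖ + 1} ∩ Fᶜ) ∧
            f ∈ toC '' (Γ : Set (Aff n)) := hf
        by_contra hne
        exact h' ⟨g, ⟨⟨hg, le_of_lt h⟩, fun e => hne (by rw [show g = γ from e]; rfl)⟩, rfl⟩
      · rintro rfl
        have h5 : toC γ ∈ ({f : C(E n, E n) | ‖f 0‖ < ‖γ 0‖ + 1} ∩ Fᶜ) :=
          ⟨lt_add_one ‖γ 0‖, hmem⟩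
        exact ⟨h5, γ, hγ, rfl⟩
  · obtain ⟨R, hR⟩ := h3
    have hc : IsCompact ((fun x => orb Γ x) '' Metric.closedBall (0 : E n) R) :=
      (isCompact_closedBall _ _).image continuous_quotient_mk'
    refine ⟨?_⟩
    convert! hc
    symm
    refine Set.eq_univ_of_forall fun p => ?_
    induction p using Quotient.inductionOn with
    | h x =>
      obtain ⟨γ, hγ, h⟩ := hR x
      exact ⟨γ x, by simpa using h, orb_eq_iff.2 ⟨γ, hγ, rfl⟩⟩

end Discrete

/-! ### The top singular space of a normal operator -/

section SpectralGap

open ContinuousLinearMap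

variable {V : Type*} [NormedAddCommGroup V] [InnerProductSpace ℝ V] [FiniteDimensional ℝ V]

theorem exists_norm_eq_one_forall_norm_apply_le (N : V →L[ℝ] V) {W : Submodule ℝ V}
    (hW : W ≠ ⊥) : ∃ x ∈ W, ‖x‖ = 1 ∧ ∀ y ∈ W, ‖N y‖ ≤ ‖N x‖ * ‖y‖ := by
  obtain ⟨w, hw, hw0⟩ := W.exists_mem_ne_zero_of_ne_bot hW
  have hs : IsCompact ((W : Set V) ∩ Metric.sphere 0 1) :=
    (isCompact_sphere _ _).inter_left W.closed_of_finiteDimensional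
  have hn : ∀ y ∈ W, y ≠ 0 → ‖y‖⁻¹ • y ∈ (W : Set V) ∩ Metric.sphere 0 1 := fun y hy hy0 =>
    ⟨W.smul_mem _ hy, by simp [norm_smul, hy0]⟩
  obtain ⟨x, ⟨hx, hx1⟩, hmax⟩ := hs.exists_isMaxOn ⟨_, hn w hw hw0⟩
    (f := fun x => ‖N x‖) (by fun_prop)
  refine ⟨x, hx, by simpa using hx1, fun y hy => ?_⟩
  rcases eq_or_ne y 0 with rfl | hy0
  · simp
  have h := hmax (hn y hy hy0)
  simp only [Set.mem_ofPred_eq, map_smul, norm_smul, norm_inv, norm_norm] at h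
  have := norm_pos_iff.2 hy0
  rwa [inv_mul_le_iff₀ this, mul_comm] at h

/-- Expanding the squared norm of the difference bounds it by `(1 - 2 + 1) ‖N‖⁴ ‖x‖² = 0`. -/
theorem adjoint_mul_self_apply_eq_of_norm (N : V →L[ℝ] V) {x : V} (hx : ‖N x‖ = ‖N‖ * ‖x‖) :
    (adjoint N * N) x = (‖N‖ ^ 2) • x := by
  have h1 : ‖(adjoint N * N) x‖ ≤ ‖N‖ * (‖N‖ * ‖x‖) := by
    refine (le_opNorm (adjoint N) (N x)).trans ?_
    rw [LinearIsometryEquiv.norm_map, hx]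
  have h2 : Inner.inner ℝ ((adjoint N * N) x) x = ‖N x‖ ^ 2 := by
    rw [← real_inner_self_eq_norm_sq]
    exact adjoint_inner_left N x (N x)
  have h3 : ‖(adjoint N * N) x - (‖N‖ ^ 2) • x‖ ^ 2 ≤ 0 := by
    rw [norm_sub_sq_real, inner_smul_right, h2, hx, norm_smul, norm_pow, norm_norm]
    have := pow_le_pow_left₀ (norm_nonneg _) h1 2
    nlinarith
  exact sub_eq_zero.1 (norm_eq_zero.1 (pow_eq_zero_iff two_ne_zero |>.1
    (le_antisymm h3 (sq_nonneg _))))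

/-- `K` is the eigenspace of `adjoint N * N` for `‖N‖ ^ 2`; by normality it is stable under `N` and
its adjoint, so `Kᗮ` is stable too. If `Kᗮ ≠ ⊥`, then `c` is the maximum of `‖N x‖` on its unit
sphere, and `c = ‖N‖` would put a maximizer into `K`. -/
theorem exists_spectral_gap (N : V →L[ℝ] V) (hN : adjoint N * N = N * adjoint N) (h0 : N ≠ 0) :
    ∃ (K : Submodule ℝ V) (c : ℝ), K ≠ ⊥ ∧ 0 ≤ c ∧ c < ‖N‖ ∧
      (∀ x ∈ K, N x ∈ K ∧ ‖N x‖ = ‖N‖ * ‖x‖) ∧ ∀ x ∈ Kᗮ, N x ∈ Kᗮ ∧ ‖N x‖ ≤ c * ‖x‖ := by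
  let K : Submodule ℝ V := LinearMap.ker (adjoint N * N - (‖N‖ ^ 2) • (1 : V →L[ℝ] V)).toLinearMap
  have hK : ∀ x, x ∈ K ↔ (adjoint N * N) x = (‖N‖ ^ 2) • x := fun x => by
    rw [LinearMap.mem_ker, ← sub_eq_zero (a := (adjoint N * N) x)]; rfl
  have hc1 : (adjoint N * N) * N = N * (adjoint N * N) := by
    rw [← mul_assoc, ← hN]
  have hc2 : (adjoint N * N) * adjoint N = adjoint N * (adjoint N * N) := by
    rw [mul_assoc, ← hN]
  have hstab : ∀ T : V →L[ℝ] V, (adjoint N * N) * T = T * (adjoint N * N) → ∀ x ∈ K, T x ∈ K := by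
    intro T hT x hx
    rw [hK] at hx ⊢
    change ((adjoint N * N) * T) x = _
    rw [hT]
    change T ((adjoint N * N) x) = _
    rw [hx, map_smul]
  have hV : (⊤ : Submodule ℝ V) ≠ ⊥ := by
    intro h
    apply h0
    ext1 x
    have : x ∈ (⊤ : Submodule ℝ V) := trivial
    rw [h, Submodule.mem_bot] at this
    simp [this]
  have hnorm : ∀ x ∈ K, ‖N x‖ = ‖N‖ * ‖x‖ := fun x hx => by
    have h2 : Inner.inner ℝ ((adjoint N * N) x) x = ‖N x‖ ^ 2 := by
      rw [← real_inner_self_eq_norm_sq]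
      exact adjoint_inner_left N x (N x)
    rw [(hK x).1 hx, inner_smul_left, real_inner_self_eq_norm_sq] at h2
    refine (pow_left_inj₀ (norm_nonneg _) (by positivity) two_ne_zero).1 ?_
    rw [← h2, mul_pow]
    rfl
  have hperp : ∀ x ∈ Kᗮ, N x ∈ Kᗮ := fun x hx => by
    rw [Submodule.mem_orthogonal] at hx ⊢
    intro u hu
    rw [← adjoint_inner_left]
    exact hx _ (hstab _ hc2 u hu)
  have hK0 : K ≠ ⊥ := by
    obtain ⟨x, -, hx1, hx⟩ := exists_norm_eq_one_forall_norm_apply_le N hV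
    have h1 : ‖N‖ ≤ ‖N x‖ := opNorm_le_bound _ (norm_nonneg _) fun y => hx y trivial
    have h2 : ‖N x‖ = ‖N‖ * ‖x‖ := le_antisymm (le_opNorm _ _) (by rwa [hx1, mul_one])
    intro h
    have : x ∈ K := (hK x).2 (adjoint_mul_self_apply_eq_of_norm N h2)
    rw [h, Submodule.mem_bot] at this
    simp [this] at hx1
  have hpos : 0 < ‖N‖ := norm_pos_iff.2 h0
  by_cases hKp : Kᗮ = ⊥
  · refine ⟨K, 0, hK0, le_rfl, hpos, fun x hx => ⟨hstab _ hc1 x hx, hnorm x hx⟩, fun x hx => ?_⟩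
    refine ⟨hperp x hx, ?_⟩
    rw [hKp, Submodule.mem_bot] at hx
    simp [hx]
  · obtain ⟨x, hxK, hx1, hx⟩ := exists_norm_eq_one_forall_norm_apply_le N hKp
    refine ⟨K, ‖N x‖, hK0, norm_nonneg _, ?_, fun x hx => ⟨hstab _ hc1 x hx, hnorm x hx⟩,
      fun y hy => ⟨hperp y hy, hx y hy⟩⟩
    refine lt_of_le_of_ne ?_ fun e => ?_
    · simpa [hx1] using le_opNorm N x
    · have : x ∈ K := (hK x).2 (adjoint_mul_self_apply_eq_of_norm N (by rw [e, hx1, mul_one]))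
      have : Inner.inner ℝ x x = (0 : ℝ) := hxK x this
      rw [real_inner_self_eq_norm_sq, hx1] at this
      norm_num at this

end SpectralGap

/-! ### Small rotational parts in a space group -/

section Bieberbach

open ContinuousLinearMap

variable {n : ℕ} {Γ : Subgroup (Aff n)}

theorem adjoint_lin {g : Aff n} (hg : Isometry g) : adjoint (lin n g) = lin n g⁻¹ := by
  symm
  rw [eq_adjoint_iff]
  intro x y
  have h := (LinearIsometry.mk (lin n g).toLinearMap (norm_lin_apply hg)).inner_map_map
    (lin n g⁻¹ x) y
  change Inner.inner ℝ (lin n g (lin n g⁻¹ x)) (lin n g y) = _ at h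
  rw [lin_apply_inv_self] at h
  exact h.symm

theorem normal_lin_sub_one {g : Aff n} (hg : Isometry g) :
    adjoint (lin n g - 1) * (lin n g - 1) = (lin n g - 1) * adjoint (lin n g - 1) := by
  have h1 : adjoint (1 : E n →L[ℝ] E n) = 1 := by
    symm
    rw [eq_adjoint_iff]
    intro x y
    rfl
  have h2 : lin n g⁻¹ * lin n g = 1 := by rw [← map_mul, inv_mul_cancel, map_one]
  have h3 : lin n g * lin n g⁻¹ = 1 := by rw [← map_mul, mul_inv_cancel, map_one]
  rw [map_sub, adjoint_lin hg, h1, sub_mul, sub_mul, mul_sub, mul_sub, mul_sub, mul_sub, h2, h3]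
  simp only [one_mul, mul_one]
  abel

/-- With `A`, `B` the linear parts, `A B A⁻¹ B⁻¹ - 1` is the ring commutator of `A - 1` and `B - 1`
times the orthogonal map `A⁻¹ B⁻¹`. -/
theorem norm_lin_commutator_sub_one_le {g h : Aff n} (hg : Isometry g) (hh : Isometry h) :
    ‖lin n (g * h * g⁻¹ * h⁻¹) - 1‖ ≤ 2 * ‖lin n g - 1‖ * ‖lin n h - 1‖ := by
  have e : lin n (g * h * g⁻¹ * h⁻¹) - 1 =
      ((lin n g - 1) * (lin n h - 1) - (lin n h - 1) * (lin n g - 1)) * lin n (g⁻¹ * h⁻¹) := by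
    have e1 : (lin n g - 1) * (lin n h - 1) - (lin n h - 1) * (lin n g - 1) =
        lin n (g * h) - lin n (h * g) := by
      rw [map_mul, map_mul]
      simp only [sub_mul, mul_sub, one_mul, mul_one]
      abel
    rw [e1, sub_mul, ← map_mul, ← map_mul, ← mul_assoc, ← map_one (lin n)]
    congr 2
    group
  rw [e]
  refine (norm_mul_lin_le (isometry_mul (isometry_inv hg) (isometry_inv hh)) _).trans ?_
  refine (norm_sub_le _ _).trans ?_
  have h1 := norm_mul_le (lin n g - 1) (lin n h - 1)
  have h2 := norm_mul_le (lin n h - 1) (lin n g - 1)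
  linarith

theorem IsSpaceGroup.exists_min (hΓ : IsSpaceGroup Γ) {S : Set (Aff n)} (hS : S ⊆ Γ)
    (hne : S.Nonempty) : ∃ γ ∈ S, ∀ γ' ∈ S, ‖γ 0‖ ≤ ‖γ' 0‖ := by
  obtain ⟨γ₁, h₁⟩ := hne
  have hfin : (S ∩ {γ | ‖γ 0‖ ≤ ‖γ₁ 0‖}).Finite :=
    (hΓ.finite_norm_le ‖γ₁ 0‖).subset fun γ hγ => ⟨hS hγ.1, hγ.2⟩
  obtain ⟨γ, hγ, hmin⟩ := Set.exists_min_image _ (fun γ : Aff n => ‖γ 0‖) hfin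
    ⟨γ₁, h₁, le_refl ‖γ₁ 0‖⟩
  refine ⟨γ, hγ.1, fun γ' h' => ?_⟩
  by_cases h : ‖γ' 0‖ ≤ ‖γ₁ 0‖
  · exact hmin γ' ⟨h', h⟩
  · exact (hmin γ₁ ⟨h₁, le_refl ‖γ₁ 0‖⟩).trans (not_le.1 h).le

/-- A space group contains elements with small rotational part translating in a direction close
to any given one. -/
theorem IsSpaceGroup.exists_small_rotation (hΓ : IsSpaceGroup Γ) {u : E n} {ε : ℝ}
    (hε : 0 < ε) : ∃ γ ∈ Γ, ∃ c : ℝ, 0 < c ∧ ‖lin n γ - 1‖ ≤ ε ∧ ‖γ 0 - c • u‖ ≤ ε * c := by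
  obtain ⟨R, hR⟩ := hΓ.exists_norm_le
  have h1 : ∀ i : ℕ, ∃ γ ∈ Γ, ‖γ 0 - (i : ℝ) • u‖ ≤ R := fun i => by
    obtain ⟨γ, hγ, h⟩ := hR ((i : ℝ) • u)
    refine ⟨γ⁻¹, Γ.inv_mem hγ, ?_⟩
    have := (hΓ.isometry γ hγ).dist_eq (γ⁻¹ 0) ((i : ℝ) • u)
    rw [aff_apply_inv_self, dist_zero_left, dist_eq_norm] at this
    rwa [← this]
  choose s hs hsR using h1
  have hf : ∀ i, lin n (s i) ∈ Metric.closedBall (0 : E n →L[ℝ] E n) 1 := fun i => by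
    rw [mem_closedBall_zero_iff]
    exact norm_lin_le_one (hΓ.isometry _ (hs i))
  obtain ⟨a, -, φ, hφ, hlim⟩ := (isCompact_closedBall _ _).tendsto_subseq hf
  obtain ⟨N, hN⟩ := Metric.cauchySeq_iff'.1 hlim.cauchySeq ε hε
  -- Dividing `s (φ j)` by `s (φ N)` makes the rotation small and moves the translation part by at
  -- most `‖s (φ N) 0‖`. For large `j` the total error `R + ‖s (φ N) 0‖` is below `ε * φ j`.
  obtain ⟨j, hj⟩ := exists_nat_gt (max (N : ℝ) ((R + ‖s (φ N) 0‖) / ε))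
  rw [max_lt_iff] at hj
  have hNj : N < j := by exact_mod_cast hj.1
  have hjφ : (j : ℝ) ≤ φ j := by exact_mod_cast hφ.id_le j
  have hi := hΓ.isometry _ (hs (φ N))
  have hij := hΓ.isometry _ (hs (φ j))
  have hj0 : (0 : ℝ) ≤ N := Nat.cast_nonneg N
  refine ⟨s (φ j) * (s (φ N))⁻¹, Γ.mul_mem (hs _) (Γ.inv_mem (hs _)), φ j, by linarith, ?_, ?_⟩
  · have e : lin n (s (φ j) * (s (φ N))⁻¹) - 1 =
        (lin n (s (φ j)) - lin n (s (φ N))) * lin n (s (φ N))⁻¹ := by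
      rw [sub_mul, ← map_mul, ← map_mul, mul_inv_cancel, map_one]
    rw [e]
    refine (norm_mul_lin_le (isometry_inv hi) _).trans ?_
    rw [← dist_eq_norm]
    exact (hN j hNj.le).le
  · have h2 := norm_apply_sub_le hij ((s (φ N))⁻¹ 0)
    rw [norm_inv_zero hi] at h2
    have h3 := hsR (φ j)
    have h4 := norm_add_le (s (φ j) ((s (φ N))⁻¹ 0) - s (φ j) 0) (s (φ j) 0 - (φ j : ℝ) • u)
    rw [sub_add_sub_cancel] at h4
    have h5 := (div_lt_iff₀ hε).1 hj.2
    rw [aff_mul_apply]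
    nlinarith

/-- The translational part of a commutator. -/
theorem commutator_apply_zero (α β : Aff n) :
    (α * β * α⁻¹ * β⁻¹) 0 = (lin n α - 1) (β 0) +
      ((1 - lin n (α * β * α⁻¹ * β⁻¹)) (β 0) + (1 - lin n (α * β * α⁻¹)) (α 0)) := by
  set κ := α * β * α⁻¹ * β⁻¹ with hκ
  -- The relation `κ β α = α β` evaluated at the origin.
  have e1 : κ (β (α 0)) = α (β 0) := by
    have : κ * (β * α) = α * β := by rw [hκ]; group
    exact congrArg (fun g : Aff n => g 0) this
  have e2 : κ * β = α * β * α⁻¹ := by rw [hκ]; group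
  rw [aff_apply κ, aff_apply α (β 0), aff_apply β (α 0), map_add, ← lin_mul_apply, e2] at e1
  change κ 0 = (lin n α (β 0) - β 0) +
    ((β 0 - lin n κ (β 0)) + (α 0 - lin n (α * β * α⁻¹) (α 0)))
  rw [← sub_eq_iff_eq_add'.2 e1.symm]
  abel

/-- Elements of a space group with small rotational part are translations. -/
theorem IsSpaceGroup.lin_eq_one_of_norm_sub_one_le (hΓ : IsSpaceGroup Γ) {γ : Aff n} (hγ : γ ∈ Γ)
    (h : ‖lin n γ - 1‖ ≤ 1 / 2) : lin n γ = 1 := by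
  by_contra hne
  -- `α` is a counterexample with shortest translation part; below, `K` is the subspace on which `α
  -- - 1` stretches most.
  obtain ⟨α, ⟨hα, hα1, hα2⟩, hαmin⟩ := hΓ.exists_min
    (S := {γ | γ ∈ Γ ∧ ‖lin n γ - 1‖ ≤ 1 / 2 ∧ lin n γ ≠ 1}) (fun _ h => h.1) ⟨γ, hγ, h, hne⟩
  have hαi := hΓ.isometry α hα
  obtain ⟨K, c, hK0, hc0, hc, hK, hKp⟩ := exists_spectral_gap (lin n α - 1)
    (normal_lin_sub_one hαi) (sub_ne_zero.2 hα2)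
  set a := ‖lin n α - 1‖ with ha
  set N := lin n α - 1 with hN
  let P : E n →L[ℝ] E n := K.starProjection
  have hPK : ∀ x, P x ∈ K := fun x => K.starProjection_apply_mem x
  have hPKp : ∀ x, x - P x ∈ Kᗮ := fun x => K.sub_starProjection_mem_orthogonal x
  have hP1 : ∀ x, ‖P x‖ ≤ ‖x‖ := fun x => K.norm_starProjection_apply_le x
  have hP2 : ∀ x, ‖x - P x‖ ≤ ‖x‖ := fun x => by
    have h1 := Submodule.norm_sq_eq_add_norm_sq_starProjection x K
    rw [K.starProjection_orthogonal_val] at h1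
    have : ‖x - P x‖ ^ 2 ≤ ‖x‖ ^ 2 := by
      rw [h1]
      exact le_add_of_nonneg_left (sq_nonneg _)
    exact le_of_sq_le_sq this (norm_nonneg _)
  have hPN : ∀ x, P (N x) = N (P x) := fun x => by
    refine Submodule.eq_starProjection_of_mem_orthogonal (hK _ (hPK x)).1 ?_
    rw [← map_sub]
    exact (hKp _ (hPKp x)).1
  -- Elements with very small rotation that translate mainly along `K`. The commutator of `α` with a
  -- shortest such `β` will again lie in `S` and be shorter than `β`, which is the contradiction.
  let S : Set (Aff n) := {β | β ∈ Γ ∧ ‖lin n β - 1‖ ≤ (a - c) / 8 ∧ ‖β 0 - P (β 0)‖ < ‖P (β 0)‖}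
  have hSne : S.Nonempty := by
    obtain ⟨u, hu, hu0⟩ := K.exists_mem_ne_zero_of_ne_bot hK0
    have hu1 := norm_pos_iff.2 hu0
    obtain ⟨β, hβ, t, ht, hβ1, hβ2⟩ := hΓ.exists_small_rotation (u := ‖u‖⁻¹ • u)
      (ε := min ((a - c) / 8) (1 / 4)) (by
        have : 0 < (a - c) / 8 := by linarith
        positivity)
    refine ⟨β, hβ, hβ1.trans (min_le_left _ _), ?_⟩
    set v := t • ‖u‖⁻¹ • u with hv
    have hvK : v ∈ K := K.smul_mem _ (K.smul_mem _ hu)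
    have hvn : ‖v‖ = t := by
      rw [hv, norm_smul, norm_smul, norm_inv, norm_norm, inv_mul_cancel₀ hu1.ne', mul_one,
        Real.norm_of_nonneg ht.le]
    have hPv : P v = v := Submodule.starProjection_eq_self_iff.2 hvK
    have h4 : ‖β 0 - v‖ ≤ t / 4 := by
      have := mul_le_mul_of_nonneg_right (min_le_right ((a - c) / 8) (1 / 4)) ht.le
      linarith
    have h5 : ‖β 0 - P (β 0)‖ ≤ t / 4 := by
      have := hP2 (β 0 - v)
      rw [map_sub, hPv, sub_sub_sub_cancel_right] at this
      exact this.trans h4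
    have h6 : ‖P (β 0) - v‖ ≤ t / 4 := by
      have := hP1 (β 0 - v)
      rw [map_sub, hPv] at this
      exact this.trans h4
    have h7 := norm_sub_norm_le v (P (β 0))
    rw [norm_sub_rev, hvn] at h7
    linarith
  obtain ⟨β, ⟨hβ, hβ1, hβ2⟩, hβmin⟩ := hΓ.exists_min (fun _ h => h.1) hSne
  have hβi := hΓ.isometry β hβ
  set b := β 0 with hb
  set mB := ‖lin n β - 1‖ with hmB
  have hmB0 : 0 ≤ mB := norm_nonneg _
  set κ := α * β * α⁻¹ * β⁻¹ with hκ
  have hκ1 : ‖lin n κ - 1‖ ≤ mB := by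
    refine (norm_lin_commutator_sub_one_le hαi hβi).trans ?_
    rw [← ha, ← hmB]
    nlinarith
  set r := (1 - lin n κ) b + (1 - lin n (α * β * α⁻¹)) (α 0) with hr
  have hκ0 : κ 0 = N b + r := commutator_apply_zero α β
  have hr1 : ‖r‖ ≤ (a - c) / 4 * ‖b‖ := by
    have h1 : ‖(1 - lin n κ) b‖ ≤ mB * ‖b‖ := by
      refine (le_opNorm _ _).trans ?_
      rw [norm_sub_rev]
      gcongr
    have h2 : ‖(1 - lin n (α * β * α⁻¹)) (α 0)‖ ≤ mB * ‖α 0‖ := by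
      refine (le_opNorm _ _).trans ?_
      have e : 1 - lin n (α * β * α⁻¹) = -(lin n α * (lin n β - 1) * lin n α⁻¹) := by
        rw [mul_sub, sub_mul, ← map_mul, ← map_mul, mul_one, ← map_mul, mul_inv_cancel, map_one,
          neg_sub]
      rw [e, norm_neg]
      gcongr
      exact (norm_mul_lin_le (isometry_inv hαi) _).trans (norm_lin_mul_le hαi _)
    -- Either `β` is a translation and `mB = 0`, or `β` is itself a counterexample and minimality of
    -- `α` gives `‖α 0‖ ≤ ‖b‖`.
    have h3 : mB * ‖α 0‖ ≤ mB * ‖b‖ := by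
      by_cases hB : lin n β = 1
      · rw [hmB, hB]
        simp
      · exact mul_le_mul_of_nonneg_left (hαmin β ⟨hβ, by linarith, hB⟩) hmB0
    have h4 := norm_add_le ((1 - lin n κ) b) ((1 - lin n (α * β * α⁻¹)) (α 0))
    have h5 := mul_le_mul_of_nonneg_right hβ1 (norm_nonneg b)
    rw [← hr] at h4
    linarith
  have hb2 : ‖b‖ < 2 * ‖P b‖ := by
    have := norm_add_le (P b) (b - P b)
    rw [add_sub_cancel] at this
    linarith
  have hPb : 0 < ‖P b‖ := (norm_nonneg _).trans_lt hβ2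
  have hr2 : 2 * ‖r‖ < (a - c) * ‖P b‖ := by nlinarith
  -- The component along `K` has norm at least `a ‖P b‖ - ‖r‖`, the one across it at most `c ‖b - P
  -- b‖ + ‖r‖`; the gap `a - c` outweighs `2 ‖r‖`.
  have hκS : κ ∈ S := by
    refine ⟨Γ.mul_mem (Γ.mul_mem (Γ.mul_mem hα hβ) (Γ.inv_mem hα)) (Γ.inv_mem hβ),
      hκ1.trans hβ1, ?_⟩
    have h1 : ‖κ 0 - P (κ 0)‖ ≤ c * ‖b - P b‖ + ‖r‖ := by
      have e : κ 0 - P (κ 0) = N (b - P b) + (r - P r) := by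
        rw [hκ0, map_add, hPN, map_sub]
        abel
      rw [e]
      exact (norm_add_le _ _).trans (add_le_add (hKp _ (hPKp b)).2 (hP2 r))
    have h2 : a * ‖P b‖ ≤ ‖P (κ 0)‖ + ‖r‖ := by
      rw [← (hK _ (hPK b)).2, ← hPN, ← add_sub_cancel_right (P (N b)) (P r), ← map_add, ← hκ0]
      exact (norm_sub_le _ _).trans (add_le_add_right (hP1 r) _)
    have h3 := mul_le_mul_of_nonneg_left hβ2.le hc0
    linarith
  have h1 := hβmin κ hκS
  -- As `a ≤ 1 / 2`, this is at most `(1/2 + 1/8) ‖b‖`, against the minimality of `β`.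
  have h2 : ‖κ 0‖ ≤ a * ‖b‖ + ‖r‖ := by
    rw [hκ0]
    exact (norm_add_le _ _).trans (add_le_add_left (le_opNorm _ _) _)
  have h3 : 0 < ‖b‖ := hPb.trans_le (hP1 b)
  nlinarith

/-- The translation vectors of a group of affinities. -/
def translations (Γ : Subgroup (Aff n)) : Submodule ℤ (E n) :=
  AddSubgroup.toIntSubmodule
    { carrier := {v | transl v ∈ Γ}
      zero_mem' := by
        change transl 0 ∈ Γ
        rw [transl_zero]
        exact Γ.one_mem
      add_mem' := fun {v w} hv hw => by
        change transl (v + w) ∈ Γ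
        rw [← transl_mul]
        exact Γ.mul_mem hv hw
      neg_mem' := fun {v} hv => by
        change transl (-v) ∈ Γ
        rw [← transl_inv]
        exact Γ.inv_mem hv }

theorem mem_translations {v : E n} : v ∈ translations Γ ↔ transl v ∈ Γ := Iff.rfl

theorem lin_mem_translations {g : Aff n} (hg : ∀ γ ∈ Γ, g * γ * g⁻¹ ∈ Γ) {v : E n}
    (hv : v ∈ translations Γ) : lin n g v ∈ translations Γ := by
  rw [mem_translations, ← conj_transl]
  exact hg _ hv

theorem IsSpaceGroup.mem_translations_of_norm (hΓ : IsSpaceGroup Γ) {γ : Aff n} (hγ : γ ∈ Γ)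
    (h : ‖lin n γ - 1‖ ≤ 1 / 2) : γ 0 ∈ translations Γ := by
  rw [mem_translations, ← eq_transl_of_lin_eq_one (hΓ.lin_eq_one_of_norm_sub_one_le hγ h)]
  exact hγ

/-- For `u` orthogonal to all translations, an element of small rotation moving nearly along `u`
would be a translation, hence orthogonal to `u`, and could not be within `c ‖u‖ / 2` of `c • u`. -/
theorem IsSpaceGroup.span_translations (hΓ : IsSpaceGroup Γ) :
    Submodule.span ℝ (translations Γ : Set (E n)) = ⊤ := by
  set W := Submodule.span ℝ (translations Γ : Set (E n)) with hW
  by_contra hne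
  obtain ⟨u, hu, hu0⟩ := Wᗮ.exists_mem_ne_zero_of_ne_bot
    (fun h => hne ((Submodule.orthogonal_eq_bot_iff).1 h))
  have hu1 := norm_pos_iff.2 hu0
  obtain ⟨γ, hγ, c, hc, h1, h2⟩ := hΓ.exists_small_rotation (u := u)
    (ε := min (1 / 2) (‖u‖ / 2)) (by positivity)
  have hγW : γ 0 ∈ W :=
    Submodule.subset_span (hΓ.mem_translations_of_norm hγ (h1.trans (min_le_left _ _)))
  have h3 : Inner.inner ℝ (γ 0) u = (0 : ℝ) := hu _ hγW
  have h4 : ‖γ 0 - c • u‖ ≤ ‖u‖ / 2 * c :=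
    h2.trans (mul_le_mul_of_nonneg_right (min_le_right _ _) hc.le)
  have h5 : ‖γ 0 - c • u‖ ^ 2 = ‖γ 0‖ ^ 2 + (c * ‖u‖) ^ 2 := by
    rw [norm_sub_sq_real, inner_smul_right, h3, norm_smul, Real.norm_of_nonneg hc.le]
    ring
  have h6 := pow_le_pow_left₀ (norm_nonneg _) h4 2
  have h7 : 0 < c * ‖u‖ := by positivity
  nlinarith [sq_nonneg ‖γ 0‖]

/-- Linear parts closer than `1 / 2` coincide, and all of them lie in a compact ball. -/
theorem IsSpaceGroup.finite_map_linearHom (hΓ : IsSpaceGroup Γ) :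
    Finite (Γ.map (AffineEquiv.linearHom : Aff n →* (E n ≃ₗ[ℝ] E n))) := by
  refine finite_of_separated (a := (0 : E n →L[ℝ] E n)) (r := 1) (ε := 1 / 2)
    (f := fun A => LinearMap.toContinuousLinearMap (A.1 : E n →ₗ[ℝ] E n)) ?_ (by norm_num) ?_
  · rintro ⟨_, γ, hγ, rfl⟩
    rw [mem_closedBall_zero_iff]
    exact norm_lin_le_one (hΓ.isometry _ hγ)
  · rintro ⟨_, g, hg, rfl⟩ ⟨_, g', hg', rfl⟩ hd
    change dist (lin n g) (lin n g') < 1 / 2 at hd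
    rw [dist_eq_norm] at hd
    refine Subtype.ext ((eq_of_inv_mul_eq_one (a := AffineEquiv.linearHom g')
      (b := AffineEquiv.linearHom g) ?_).symm)
    rw [← map_inv, ← map_mul, linearHom_eq_one_iff]
    refine hΓ.lin_eq_one_of_norm_sub_one_le (Γ.mul_mem (Γ.inv_mem hg') hg) ?_
    have e : lin n (g'⁻¹ * g) - 1 = lin n g'⁻¹ * (lin n g - lin n g') := by
      rw [mul_sub, ← map_mul, ← map_mul, inv_mul_cancel, map_one]
    rw [e]
    exact (norm_lin_mul_le (isometry_inv (hΓ.isometry _ hg')) _).trans hd.le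

theorem IsSpaceGroup.discreteTopology_translations (hΓ : IsSpaceGroup Γ) :
    DiscreteTopology (translations Γ) := by
  have hfin : (Metric.ball (0 : E n) 1 ∩ (translations Γ : Set (E n))).Finite := by
    refine Set.Finite.of_finite_image ((hΓ.finite_norm_le 1).subset ?_)
      (transl_injective (n := n)).injOn
    rintro _ ⟨v, ⟨hv, hvT⟩, rfl⟩
    refine ⟨hvT, ?_⟩
    simpa using (mem_ball_zero_iff.1 hv).le
  refine (discreteTopology_iff_isOpen_singleton_zero).2 ?_
  have hf2 : (Subtype.val ⁻¹' Metric.ball (0 : E n) 1 : Set (translations Γ)).Finite := by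
    refine Set.Finite.of_finite_image (f := Subtype.val) (hfin.subset ?_) Subtype.val_injective.injOn
    rintro _ ⟨v, hv, rfl⟩
    exact ⟨hv, v.2⟩
  have := (hf2.subset (Set.sdiff_subset (t := {0}))).isClosed.isOpen_compl.inter
    (Metric.isOpen_ball.preimage (continuous_subtype_val (p := (· ∈ translations Γ))) :
      IsOpen (Subtype.val ⁻¹' Metric.ball (0 : E n) 1 : Set (translations Γ)))
  convert! this
  ext v
  simp only [Set.mem_singleton_iff, Set.mem_inter_iff, Set.mem_compl_iff, Set.mem_sdiff, not_and,
    not_not]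
  constructor
  · rintro rfl
    exact ⟨fun _ => rfl, by simp⟩
  · rintro ⟨h1, h2⟩
    exact h1 h2

theorem IsSpaceGroup.isZLattice_translations (hΓ : IsSpaceGroup Γ) :
    @IsZLattice ℝ _ (E n) _ _ (translations Γ) hΓ.discreteTopology_translations :=
  letI := hΓ.discreteTopology_translations
  ⟨hΓ.span_translations⟩

end Bieberbach

/-! ### Automorphisms of a space group -/

section Rigidity

variable {n : ℕ} {Γ : Subgroup (Aff n)}

/-- A ℤ-basis of the translation lattice is an ℝ-basis of the space. -/
theorem IsSpaceGroup.exists_linear_extension (hΓ : IsSpaceGroup Γ)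
    (F : translations Γ →ₗ[ℤ] E n) : ∃ A : E n →ₗ[ℝ] E n, ∀ v, A v.1 = F v := by
  let _ := hΓ.discreteTopology_translations
  have := hΓ.isZLattice_translations
  have : Module.Finite ℤ (translations Γ) := ZLattice.module_finite ℝ _
  have : Module.Free ℤ (translations Γ) := ZLattice.module_free ℝ _
  let b := Module.Free.chooseBasis ℤ (translations Γ)
  let A := (b.ofZLatticeBasis ℝ).constr ℝ (fun i => F (b i))
  refine ⟨A, fun v => ?_⟩
  have : (A.restrictScalars ℤ).comp (translations Γ).subtype = F := by
    refine b.ext fun i => ?_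
    have := (b.ofZLatticeBasis ℝ).constr_basis ℝ (fun i => F (b i)) i
    rwa [Module.Basis.ofZLatticeBasis_apply] at this
  exact LinearMap.congr_fun this v

theorem IsSpaceGroup.linearMap_ext (hΓ : IsSpaceGroup Γ) {A B : E n →ₗ[ℝ] E n}
    (h : ∀ v ∈ translations Γ, A v = B v) : A = B :=
  LinearMap.ext_on hΓ.span_translations h

/-- Commuting with the translation by `j • v` means fixing `v` linearly, and such `v` span. The
exponent is there for automorphisms: the preimage of a translation is only known to become a
translation after raising to a power. -/
theorem IsSpaceGroup.lin_eq_one_of_commute (hΓ : IsSpaceGroup Γ) {g : Aff n} {j : ℕ} (hj : j ≠ 0)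
    (h : ∀ v ∈ translations Γ, Commute g (transl v ^ j)) : lin n g = 1 := by
  have : ((lin n g : E n →L[ℝ] E n) : E n →ₗ[ℝ] E n) = LinearMap.id := by
    refine hΓ.linearMap_ext fun v hv => ?_
    have h1 := h v hv
    have hp : transl v ^ j = transl (j • v) := (AffineEquiv.constVAdd_nsmul ℝ (E n) j v).symm
    rw [hp, commute_iff_eq, ← mul_inv_eq_iff_eq_mul, conj_transl] at h1
    have h2 := transl_injective h1
    rw [map_nsmul, ← Nat.cast_smul_eq_nsmul ℝ, ← Nat.cast_smul_eq_nsmul ℝ] at h2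
    exact smul_right_injective _ (Nat.cast_ne_zero.2 hj) h2
  ext1 x
  exact LinearMap.congr_fun this x

theorem IsSpaceGroup.exists_pow (hΓ : IsSpaceGroup Γ) :
    ∃ j : ℕ, j ≠ 0 ∧ ∀ γ ∈ Γ, lin n (γ ^ j) = 1 := by
  have := hΓ.finite_map_linearHom
  refine ⟨_, Nat.card_pos (α := Γ.map (AffineEquiv.linearHom : Aff n →* (E n ≃ₗ[ℝ] E n))).ne',
    fun γ hγ => ?_⟩
  rw [← linearHom_eq_one_iff, map_pow]
  have := pow_card_eq_one' (x := (⟨_, γ, hγ, rfl⟩ :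
    Γ.map (AffineEquiv.linearHom : Aff n →* (E n ≃ₗ[ℝ] E n))))
  exact congrArg Subtype.val this

theorem commute_of_lin_eq_one {g h : Aff n} (hg : lin n g = 1) (hh : lin n h = 1) :
    Commute g h := by
  rw [eq_transl_of_lin_eq_one hg, eq_transl_of_lin_eq_one hh, commute_iff_eq, transl_mul,
    transl_mul, add_comm]

/-- Automorphisms of a space group preserve translations. -/
theorem IsSpaceGroup.lin_mulAut_eq_one (hΓ : IsSpaceGroup Γ) (ζ : MulAut Γ) {γ : Γ}
    (hγ : lin n γ.1 = 1) : lin n (ζ γ).1 = 1 := by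
  obtain ⟨j, hj0, hj⟩ := hΓ.exists_pow
  refine hΓ.lin_eq_one_of_commute hj0 fun v hv => ?_
  obtain ⟨τ, hτ⟩ := ζ.surjective ⟨transl v, hv⟩
  have h1 : Commute γ (τ ^ j) := by
    have := commute_of_lin_eq_one hγ (hj τ.1 τ.2)
    exact Subtype.ext this
  have h2 := h1.map ζ
  rw [map_pow, hτ] at h2
  exact congrArg Subtype.val h2

/-- A crossed homomorphism to `ℝⁿ` that vanishes on translations is principal. -/
theorem IsSpaceGroup.exists_eq_sub_of_cocycle (hΓ : IsSpaceGroup Γ) (d : Γ → E n)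
    (hd : ∀ γ γ', d (γ * γ') = d γ + lin n γ.1 (d γ'))
    (hT : ∀ γ, lin n γ.1 = 1 → d γ = 0) : ∃ x, ∀ γ, d γ = x - lin n γ.1 x := by
  let Q := Γ.map (AffineEquiv.linearHom : Aff n →* (E n ≃ₗ[ℝ] E n))
  have : Finite Q := hΓ.finite_map_linearHom
  let _ : Fintype Q := Fintype.ofFinite Q
  let f : Γ →* Q := (AffineEquiv.linearHom.comp Γ.subtype).codRestrict Q
    (fun γ => ⟨γ.1, γ.2, rfl⟩)
  have hf : Function.Surjective f := by
    rintro ⟨_, γ, hγ, rfl⟩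
    exact ⟨⟨γ, hγ⟩, rfl⟩
  -- Vanishing on translations lets `d` descend to the finite point group, where summing the cocycle
  -- identity exhibits it as principal.
  have hdf : ∀ γ γ', f γ = f γ' → d γ = d γ' := fun γ γ' h => by
    have h1 : lin n (γ⁻¹ * γ').1 = 1 := by
      rw [← linearHom_eq_one_iff]
      have : f (γ⁻¹ * γ') = 1 := by rw [map_mul, map_inv, h, inv_mul_cancel]
      exact congrArg Subtype.val this
    have h2 := hd γ (γ⁻¹ * γ')
    rw [hT _ h1, map_zero, add_zero, mul_inv_cancel_left] at h2
    exact h2.symm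
  choose s hs using hf
  let D : Q → E n := fun q => d (s q)
  have hD : ∀ γ, D (f γ) = d γ := fun γ => hdf _ _ (hs _)
  have hsum : ∀ γ, ∑ q, D q = (Fintype.card Q : ℝ) • d γ + lin n γ.1 (∑ q, D q) := fun γ => by
    conv_lhs => rw [← Equiv.sum_comp (Equiv.mulLeft (f γ))]
    rw [map_sum, Nat.cast_smul_eq_nsmul, ← Finset.card_univ,
      ← Finset.sum_const, ← Finset.sum_add_distrib]
    refine Finset.sum_congr rfl fun q _ => ?_
    have : f γ * q = f (γ * s q) := by rw [map_mul, hs]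
    change D (f γ * q) = _
    rw [this, hD, hd]
  refine ⟨(Fintype.card Q : ℝ)⁻¹ • ∑ q, D q, fun γ => ?_⟩
  have hc : (Fintype.card Q : ℝ) ≠ 0 := Nat.cast_ne_zero.2 Fintype.card_ne_zero
  rw [map_smul, ← smul_sub, sub_eq_of_eq_add (hsum γ), inv_smul_smul₀ hc]

/-- Every automorphism of a space group is conjugation by an affinity. -/
theorem IsSpaceGroup.exists_conj_eq (hΓ : IsSpaceGroup Γ) (ζ : MulAut Γ) :
    ∃ g : Aff n, ∀ γ : Γ, (ζ γ).1 = g * γ.1 * g⁻¹ := by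
  -- The action of `ζ` on the lattice extends linearly to `A`, and that of `ζ⁻¹` provides an
  -- inverse.
  have key : ∀ ζ : MulAut Γ, ∃ A : E n →ₗ[ℝ] E n, ∀ v (hv : v ∈ translations Γ),
      (ζ ⟨transl v, hv⟩).1 = transl (A v) := fun ζ => by
    let F : translations Γ →+ E n :=
      { toFun := fun v => (ζ ⟨transl v.1, v.2⟩).1 0
        map_zero' := by
          have : (⟨transl (0 : translations Γ).1, (0 : translations Γ).2⟩ : Γ) = 1 :=
            Subtype.ext transl_zero
          rw [this, map_one]
          rfl
        map_add' := fun v w => by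
          have : (⟨transl (v + w).1, (v + w).2⟩ : Γ) =
              ⟨transl v.1, v.2⟩ * ⟨transl w.1, w.2⟩ := Subtype.ext (transl_mul _ _).symm
          rw [this, map_mul]
          change (ζ ⟨transl v.1, v.2⟩).1 ((ζ ⟨transl w.1, w.2⟩).1 0) = _
          rw [aff_apply, hΓ.lin_mulAut_eq_one ζ (lin_transl _), add_comm]
          rfl }
    obtain ⟨A, hA⟩ := hΓ.exists_linear_extension F.toIntLinearMap
    refine ⟨A, fun v hv => ?_⟩
    rw [hA ⟨v, hv⟩]
    exact eq_transl_of_lin_eq_one (hΓ.lin_mulAut_eq_one ζ (lin_transl _))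
  obtain ⟨A, hA⟩ := key ζ
  obtain ⟨B, hB⟩ := key ζ⁻¹
  have hAT : ∀ v, v ∈ translations Γ → A v ∈ translations Γ := fun v hv => by
    rw [mem_translations, ← hA v hv]
    exact (ζ _).2
  have hBA : B ∘ₗ A = LinearMap.id := hΓ.linearMap_ext fun v hv => by
    refine transl_injective ?_
    rw [LinearMap.comp_apply, ← hB _ (hAT v hv)]
    have : (⟨transl (A v), hAT v hv⟩ : Γ) = ζ ⟨transl v, hv⟩ := Subtype.ext (hA v hv).symm
    rw [this, MulAut.inv_apply_self]
    rfl
  have hAi : Function.Injective A := fun x y h => by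
    have := congrArg B h
    rw [← LinearMap.comp_apply, ← LinearMap.comp_apply, hBA] at this
    exact this
  let a : Aff n := (LinearEquiv.ofInjectiveEndo A hAi).toAffineEquiv
  have haA : ∀ x, lin n a x = A x := fun _ => rfl
  have ha : ∀ x, a x = A x := fun _ => rfl
  have hlin : ∀ γ : Γ, lin n (ζ γ).1 * lin n a = lin n a * lin n γ.1 := fun γ => by
    have : ((lin n (ζ γ).1 * lin n a : E n →L[ℝ] E n) : E n →ₗ[ℝ] E n) =
        ((lin n a * lin n γ.1 : E n →L[ℝ] E n) : E n →ₗ[ℝ] E n) := hΓ.linearMap_ext fun v hv => by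
      have hv' : lin n γ.1 v ∈ translations Γ := lin_mem_translations
        (fun γ' h => Γ.mul_mem (Γ.mul_mem γ.2 h) (Γ.inv_mem γ.2)) hv
      refine transl_injective ?_
      change transl (lin n (ζ γ).1 (A v)) = transl (A (lin n γ.1 v))
      rw [← conj_transl, ← hA v hv, ← hA _ hv']
      have : (⟨transl (lin n γ.1 v), hv'⟩ : Γ) = γ * ⟨transl v, hv⟩ * γ⁻¹ :=
        Subtype.ext (conj_transl _ _).symm
      rw [this, map_mul, map_mul, map_inv]
      rfl
    ext1 x
    exact LinearMap.congr_fun this x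
  -- After undoing `a`, the homomorphism keeps linear parts and fixes translations. The change in
  -- translation parts is then a cocycle vanishing on the lattice, which conjugation by one
  -- translation `x` absorbs.
  let h : Γ →* Aff n := (MulAut.conj a⁻¹).toMonoidHom.comp (Γ.subtype.comp ζ.toMonoidHom)
  have hh : ∀ γ : Γ, h γ = a⁻¹ * (ζ γ).1 * a := fun γ => by
    change a⁻¹ * (ζ γ).1 * (a⁻¹)⁻¹ = _
    rw [inv_inv]
  have hhl : ∀ γ : Γ, lin n (h γ) = lin n γ.1 := fun γ => by
    rw [hh, map_mul, map_mul, mul_assoc, hlin, ← mul_assoc, ← map_mul, inv_mul_cancel, map_one,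
      one_mul]
  obtain ⟨x, hx⟩ := hΓ.exists_eq_sub_of_cocycle (fun γ => h γ 0 - γ.1 0) (fun γ γ' => by
    have e1 : h (γ * γ') 0 = lin n γ.1 (h γ' 0) + h γ 0 := by
      rw [map_mul, aff_mul_apply, aff_apply (h γ), hhl]
    have e2 : (γ * γ').1 0 = lin n γ.1 (γ'.1 0) + γ.1 0 := aff_apply γ.1 (γ'.1 0)
    rw [e1, e2, map_sub]
    abel) (fun γ hγ => by
    have e := eq_transl_of_lin_eq_one hγ
    have hT : γ.1 0 ∈ translations Γ := by
      rw [mem_translations, ← e]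
      exact γ.2
    have e' : γ = ⟨transl (γ.1 0), hT⟩ := Subtype.ext e
    have : a⁻¹ * transl (A (γ.1 0)) * a = transl (γ.1 0) := by
      rw [← haA, ← conj_transl]
      group
    change h γ 0 - γ.1 0 = 0
    rw [hh, e', hA _ hT, this, transl_apply, add_zero]
    exact sub_self _)
  refine ⟨a * transl x, fun γ => ?_⟩
  have e : h γ = transl x * γ.1 * (transl x)⁻¹ := by
    refine aff_ext ?_ ?_
    · rw [hhl, map_mul, map_mul, transl_inv, lin_transl, lin_transl, one_mul, mul_one]
    · rw [aff_mul_apply, aff_mul_apply, transl_inv, transl_apply, transl_apply, aff_apply γ.1,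
        add_zero, map_neg, sub_eq_iff_eq_add.1 (hx γ)]
      abel
  calc (ζ γ).1 = a * h γ * a⁻¹ := by rw [hh]; group
    _ = _ := by rw [e]; group

/-- Summing over the point group `Q` sends a lattice vector to an invariant lattice vector, that is,
to a central translation, hence to 0. The sum thus vanishes identically, yet it multiplies an
invariant `x` by the order of `Q`. -/
theorem IsSpaceGroup.eq_zero_of_forall_lin_apply_eq (hΓ : IsSpaceGroup Γ)
    (hc : Subgroup.center Γ = ⊥) {x : E n} (hx : ∀ γ ∈ Γ, lin n γ x = x) : x = 0 := by
  let Q := Γ.map (AffineEquiv.linearHom : Aff n →* (E n ≃ₗ[ℝ] E n))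
  have : Finite Q := hΓ.finite_map_linearHom
  let _ : Fintype Q := Fintype.ofFinite Q
  let S : E n →ₗ[ℝ] E n := ∑ q : Q, (q.1 : E n →ₗ[ℝ] E n)
  have hSv : ∀ v, S v = ∑ q : Q, q.1 v := fun v => by simp [S]
  have hS0 : S = 0 := hΓ.linearMap_ext fun v hv => by
    have h1 : S v ∈ translations Γ := by
      rw [hSv]
      refine Submodule.sum_mem _ fun q _ => ?_
      obtain ⟨_, γ, hγ, rfl⟩ := q
      exact lin_mem_translations
        (fun γ' h => Γ.mul_mem (Γ.mul_mem hγ h) (Γ.inv_mem hγ)) hv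
    have h2 : ∀ γ ∈ Γ, lin n γ (S v) = S v := fun γ hγ => by
      rw [hSv, map_sum]
      conv_rhs => rw [← Equiv.sum_comp (Equiv.mulLeft (⟨_, γ, hγ, rfl⟩ : Q))]
      rfl
    have h3 : (⟨transl (S v), h1⟩ : Γ) ∈ Subgroup.center Γ := by
      rw [Subgroup.mem_center_iff]
      rintro ⟨γ, hγ⟩
      refine Subtype.ext ?_
      change γ * transl (S v) = transl (S v) * γ
      rw [← mul_inv_eq_iff_eq_mul, conj_transl, h2 γ hγ]
    rw [hc, Subgroup.mem_bot] at h3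
    have h4 := congrArg Subtype.val h3
    exact transl_injective (h4.trans transl_zero.symm)
  have h : S x = (Fintype.card Q : ℝ) • x := by
    rw [hSv, Nat.cast_smul_eq_nsmul, ← Finset.card_univ, ← Finset.sum_const]
    refine Finset.sum_congr rfl fun q _ => ?_
    obtain ⟨_, γ, hγ, rfl⟩ := q
    exact hx γ hγ
  rw [hS0, LinearMap.zero_apply] at h
  exact (smul_eq_zero.1 h.symm).resolve_left (Nat.cast_ne_zero.2 Fintype.card_ne_zero)

/-- The centralizer of a centerless space group in the group of affinities is trivial. -/
theorem IsSpaceGroup.eq_one_of_commute (hΓ : IsSpaceGroup Γ) (hc : Subgroup.center Γ = ⊥)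
    {g : Aff n} (hg : ∀ γ ∈ Γ, Commute g γ) : g = 1 := by
  have h1 : lin n g = 1 := hΓ.lin_eq_one_of_commute one_ne_zero fun v hv =>
    (hg _ hv).pow_right 1
  have h2 := eq_transl_of_lin_eq_one h1
  have h3 : g 0 = 0 := hΓ.eq_zero_of_forall_lin_apply_eq hc fun γ hγ => by
    have := (hg γ hγ).symm
    rw [h2, commute_iff_eq, ← mul_inv_eq_iff_eq_mul, conj_transl] at this
    simpa using transl_injective this
  rw [h2, h3, transl_zero]

/-! ### Affinities of the orbit space and outer automorphisms -/

theorem exists_isLift {g : Aff n} (hg : g ∈ Subgroup.normalizer (Γ : Set (Aff n))) :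
    ∃ β : Equiv.Perm (Orb Γ), IsLift β g := by
  have h := Subgroup.mem_normalizer_iff.1 hg
  refine ⟨Quotient.congr g.toEquiv ?_, fun _ => rfl⟩
  intro x y
  constructor
  · rintro ⟨γ, rfl⟩
    refine ⟨⟨g * γ.1 * g⁻¹, (h _).1 γ.2⟩, ?_⟩
    change g (γ.1 (g⁻¹ (g y))) = g (γ.1 y)
    rw [aff_inv_apply_self]
  · rintro ⟨⟨γ, hγ⟩, e⟩
    refine ⟨⟨g⁻¹ * γ * g, (h _).2 ?_⟩, ?_⟩
    · convert! hγ using 1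
      group
    · change γ (g y) = g x at e
      change g⁻¹ (γ (g y)) = x
      rw [e, aff_inv_apply_self]

theorem IsLift.unique {β β' : Equiv.Perm (Orb Γ)} {g : Aff n} (h : IsLift β g)
    (h' : IsLift β' g) : β = β' := by
  ext1 p
  induction p using Quotient.inductionOn with
  | h x => exact (h x).trans (h' x).symm

theorem isLift_one_of_mem {γ : Aff n} (hγ : γ ∈ Γ) : IsLift (1 : Equiv.Perm (Orb Γ)) γ := fun _ =>
  (orb_eq_iff.2 ⟨γ, hγ, rfl⟩).symm

theorem Omega_surjective (hΓ : IsSpaceGroup Γ) : Function.Surjective (Omega hΓ) := by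
  intro q
  induction q using QuotientGroup.induction_on with
  | H ζ =>
    obtain ⟨g, hg⟩ := hΓ.exists_conj_eq ζ
    obtain ⟨β, hβ⟩ := exists_isLift (Γ := Γ) (g := g) (by
      rw [Subgroup.mem_normalizer_iff]
      refine fun γ => ⟨fun hγ => ?_, fun hγ => ?_⟩
      · rw [← hg ⟨γ, hγ⟩]
        exact (ζ _).2
      · obtain ⟨γ', h⟩ := ζ.surjective ⟨_, hγ⟩
        have h := congrArg Subtype.val h
        rw [hg] at h
        have : γ'.1 = γ := by simpa using h
        exact this ▸ γ'.2)
    refine ⟨⟨β, g, hβ⟩, ?_⟩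
    rw [Omega_apply hΓ _ hβ]
    refine congrArg (QuotientGroup.mk' (inner Γ)) ?_
    ext γ : 2
    exact (hg γ).symm

/-- If conjugation by a lift `g` agrees with conjugation by some `γ ∈ Γ`, then `γ⁻¹ * g` centralizes
`Γ`, so `g = γ` induces the identity on orbits. -/
theorem Omega_injective (hΓ : IsSpaceGroup Γ) (hc : Subgroup.center Γ = ⊥) :
    Function.Injective (Omega hΓ) := by
  rw [injective_iff_map_eq_one]
  rintro ⟨β, g, hβ⟩ h
  rw [Omega_apply hΓ _ hβ] at h
  obtain ⟨γ, hγ⟩ := (QuotientGroup.eq_one_iff _).1 h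
  have e : γ.1⁻¹ * g = 1 := hΓ.eq_one_of_commute hc fun τ hτ => by
    have : γ.1 * τ * γ.1⁻¹ = g * τ * g⁻¹ := congrArg (fun f : MulAut Γ => (f ⟨τ, hτ⟩).1) hγ
    calc γ.1⁻¹ * g * τ = γ.1⁻¹ * (g * τ * g⁻¹) * g := by group
      _ = τ * (γ.1⁻¹ * g) := by rw [← this]; group
  have e' : g = γ.1 := (eq_of_inv_mul_eq_one e).symm
  exact Subtype.ext (hβ.unique (e' ▸ isLift_one_of_mem γ.2))

end Rigidity

/-! ### Outer actions of group extensions -/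

section Extensions

variable {G₁ G₂ G H K : Type*} [Group G₁] [Group G₂] [Group G] [Group H] [Group K]

theorem outCongr_trans (α : G ≃* H) (β : H ≃* K) (x : Out G) :
    outCongr (α.trans β) x = outCongr β (outCongr α x) := by
  induction x using QuotientGroup.induction_on with
  | H ζ => rfl

theorem outCongr_mulAut (A : MulAut G) (x : Out G) :
    outCongr A x = (QuotientGroup.mk A : Out G) * x * (QuotientGroup.mk A)⁻¹ := by
  induction x using QuotientGroup.induction_on with
  | H ζ => rfl

/-- The isomorphism of normal subgroups induced by an isomorphism of groups. -/
def restrictEquiv {N₁ : Subgroup G₁} {N₂ : Subgroup G₂} (φ : G₁ ≃* G₂)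
    (h : N₁.map φ.toMonoidHom = N₂) : N₁ ≃* N₂ :=
  (φ.subgroupMap N₁).trans (MulEquiv.subgroupCongr h)

theorem coe_restrictEquiv {N₁ : Subgroup G₁} {N₂ : Subgroup G₂} (φ : G₁ ≃* G₂)
    (h : N₁.map φ.toMonoidHom = N₂) (x : N₁) : (restrictEquiv φ h x : G₂) = φ x := rfl

theorem outCongr_restrictEquiv_conjOut {N₁ : Subgroup G₁} {N₂ : Subgroup G₂} [N₁.Normal]
    [N₂.Normal] (φ : G₁ ≃* G₂) (h : N₁.map φ.toMonoidHom = N₂) (x : G₁ ⧸ N₁) :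
    outCongr (restrictEquiv φ h) (conjOut N₁ x) =
      conjOut N₂ (QuotientGroup.congr N₁ N₂ φ h x) := by
  induction x using QuotientGroup.induction_on with
  | H g =>
    rw [conjOut_mk, outCongr_mk]
    refine congrArg (QuotientGroup.mk : MulAut N₂ → Out N₂) ?_
    ext y
    obtain ⟨y, rfl⟩ := (restrictEquiv φ h).surjective y
    simp only [MulEquiv.trans_apply, MulEquiv.symm_apply_apply, coe_restrictEquiv,
      MulAut.conjNormal_apply, map_mul, map_inv]
    rfl

/-- Two elements of one coset with the same action on `N₂` differ by an element of the center of
`N₂`. -/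
theorem compatible_lift_unique {N₁ : Subgroup G₁} {N₂ : Subgroup G₂} [N₂.Normal]
    (hc : Subgroup.center N₂ = ⊥) (κ : N₁ ≃* N₂) {φ : N₁ → N₁} {g g' : G₂} (h : (g : G₂ ⧸ N₂) = g')
    (hg : ∀ ν, κ (φ ν) = MulAut.conjNormal g (κ ν))
    (hg' : ∀ ν, κ (φ ν) = MulAut.conjNormal g' (κ ν)) : g = g' := by
  have hn : g⁻¹ * g' ∈ N₂ := QuotientGroup.eq.1 h
  have : (⟨g⁻¹ * g', hn⟩ : N₂) ∈ Subgroup.center N₂ := by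
    rw [Subgroup.mem_center_iff]
    intro y
    obtain ⟨ν, rfl⟩ := κ.surjective y
    have h1 := congrArg (Subtype.val (p := (· ∈ N₂))) ((hg ν).symm.trans (hg' ν))
    rw [MulAut.conjNormal_apply, MulAut.conjNormal_apply] at h1
    refine Subtype.ext ?_
    change (κ ν : G₂) * (g⁻¹ * g') = g⁻¹ * g' * κ ν
    calc (κ ν : G₂) * (g⁻¹ * g') = g⁻¹ * (g * κ ν * g⁻¹) * g' := by group
      _ = _ := by rw [h1]; group
  rw [hc, Subgroup.mem_bot] at this
  exact eq_of_inv_mul_eq_one (congrArg Subtype.val this)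

variable {N₁ : Subgroup G₁} {N₂ : Subgroup G₂} [N₁.Normal] [N₂.Normal]

/-- Any representative of `q g` acts correctly up to an inner automorphism of `N₂`, which is
absorbed by changing the representative within its coset. -/
theorem exists_compatible_lift (κ : N₁ ≃* N₂) (q : G₁ ⧸ N₁ ≃* G₂ ⧸ N₂)
    (H : ∀ x, outCongr κ (conjOut N₁ x) = conjOut N₂ (q x)) (g : G₁) :
    ∃ g' : G₂, (g' : G₂ ⧸ N₂) = q g ∧
      ∀ ν, κ (MulAut.conjNormal g ν) = MulAut.conjNormal g' (κ ν) := by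
  obtain ⟨h, hh⟩ := QuotientGroup.mk_surjective (q g)
  have e := H g
  rw [← hh, conjOut_mk, conjOut_mk, outCongr_mk, eq_comm, QuotientGroup.eq] at e
  obtain ⟨n, hn⟩ := e
  refine ⟨h * n.1, ?_, fun ν => ?_⟩
  · rw [QuotientGroup.mk_mul, (QuotientGroup.eq_one_iff n.1).2 n.2, mul_one, hh]
  · rw [eq_inv_mul_iff_mul_eq] at hn
    have := DFunLike.congr_fun hn (κ ν)
    simp only [MulEquiv.trans_apply, MulEquiv.symm_apply_apply, MulAut.mul_apply] at this
    rw [← this, map_mul, MulAut.mul_apply, MulAut.conjNormal_val]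

/-- Extensions of a centerless group are determined by the outer action of the quotient. -/
theorem exists_equiv_of_conjOut (hc₁ : Subgroup.center N₁ = ⊥) (hc₂ : Subgroup.center N₂ = ⊥)
    (κ : N₁ ≃* N₂) (q : G₁ ⧸ N₁ ≃* G₂ ⧸ N₂)
    (H : ∀ x, outCongr κ (conjOut N₁ x) = conjOut N₂ (q x)) :
    ∃ φ : G₁ ≃* G₂, N₁.map φ.toMonoidHom = N₂ := by
  choose f hfq hf using exists_compatible_lift κ q H
  have hinv : ∀ y, outCongr κ.symm (conjOut N₂ y) = conjOut N₁ (q.symm y) := fun y => by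
    obtain ⟨x, rfl⟩ := q.surjective y
    rw [← H, ← outCongr_trans, MulEquiv.self_trans_symm, MulEquiv.symm_apply_apply]
    generalize conjOut N₁ x = z
    induction z using QuotientGroup.induction_on with
    | H ζ => rfl
  -- Both `f (a * b)` and `f a * f b` are compatible lifts of `a * b`, so uniqueness gives
  -- multiplicativity.
  let F : G₁ →* G₂ := MonoidHom.mk' f fun a b =>
    compatible_lift_unique hc₂ κ (φ := MulAut.conjNormal (a * b))
      (by rw [hfq, QuotientGroup.mk_mul, QuotientGroup.mk_mul, map_mul, hfq, hfq]) (hf _)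
      (fun ν => by rw [map_mul, MulAut.mul_apply, hf, hf, map_mul, MulAut.mul_apply])
  have hmem : ∀ g, F g ∈ N₂ ↔ g ∈ N₁ := fun g => by
    rw [← QuotientGroup.eq_one_iff, ← QuotientGroup.eq_one_iff g]
    change (f g : G₂ ⧸ N₂) = 1 ↔ _
    rw [hfq, map_eq_one_iff q q.injective]
  have hinj : Function.Injective F := by
    rw [injective_iff_map_eq_one]
    intro g hg
    have hgN : g ∈ N₁ := by
      rw [← hmem, hg]
      exact N₂.one_mem
    have hgc : (⟨g, hgN⟩ : N₁) ∈ Subgroup.center N₁ := by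
      rw [Subgroup.mem_center_iff]
      intro ν
      have h1 := hf g ν
      rw [show f g = 1 from hg, map_one, MulAut.one_apply] at h1
      have h2 := congrArg Subtype.val (κ.injective h1)
      rw [MulAut.conjNormal_apply, mul_inv_eq_iff_eq_mul] at h2
      exact Subtype.ext h2.symm
    rw [hc₁, Subgroup.mem_bot] at hgc
    exact congrArg Subtype.val hgc
  have hsurj : Function.Surjective F := fun g' => by
    obtain ⟨g, hgq, hg⟩ := exists_compatible_lift κ.symm q.symm hinv g'
    refine ⟨g, compatible_lift_unique hc₂ κ (φ := MulAut.conjNormal g) ?_ (hf g) fun ν => ?_⟩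
    · change (f g : G₂ ⧸ N₂) = _
      rw [hfq, hgq, MulEquiv.apply_symm_apply]
    · have := hg (κ ν)
      rw [MulEquiv.symm_apply_apply] at this
      rw [← this, MulEquiv.apply_symm_apply]
  refine ⟨MulEquiv.ofBijective F ⟨hinj, hsurj⟩, ?_⟩
  ext y
  constructor
  · rintro ⟨g, hg, rfl⟩
    exact (hmem g).2 hg
  · intro hy
    obtain ⟨g, rfl⟩ := hsurj y
    exact ⟨g, (hmem g).1 hy, rfl⟩

theorem center_eq_bot_of_equiv (e : G ≃* H) (h : Subgroup.center H = ⊥) :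
    Subgroup.center G = ⊥ := by
  rw [eq_bot_iff]
  intro z hz
  have : e z ∈ Subgroup.center H := by
    rw [Subgroup.mem_center_iff] at hz ⊢
    intro y
    obtain ⟨x, rfl⟩ := e.surjective y
    rw [← map_mul, hz, map_mul]
  rw [h, Subgroup.mem_bot] at this
  exact (map_eq_one_iff e e.injective).1 this

end Extensions

/-! ### Finiteness of the outer action on a normal subgroup -/

section FiniteOut

variable {n : ℕ} {Γ : Subgroup (Aff n)}

theorem conj_transl_eq (g : Aff n) (v : E n) :
    transl v * g * (transl v)⁻¹ = transl (v - lin n g v) * g := by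
  rw [sub_eq_add_neg, ← map_neg, ← transl_mul, ← conj_transl, transl_inv]
  group

/-- Here `r` is the order of the point group `Q` of `N`, and `s` is the sum of the `v - q v` over
`Q`. Each summand is a commutator of the translation `v` with an element of `N`, so it lies in `N`.
The remainder `r • v - s` is the sum of the `q v`; it is fixed by `Q`, so the corresponding
translation commutes with `N`. -/
theorem IsSpaceGroup.exists_conj_smul_eq_conj (hΓ : IsSpaceGroup Γ) (N : Subgroup Γ) [N.Normal] :
    ∃ r : ℕ, r ≠ 0 ∧ ∀ v ∈ translations Γ, ∃ s ∈ translations (N.map Γ.subtype), ∀ ν ∈ N,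
      transl (r • v) * ν * (transl (r • v))⁻¹ = transl s * ν.1 * (transl s)⁻¹ := by
  let Q := (N.map Γ.subtype).map (AffineEquiv.linearHom : Aff n →* (E n ≃ₗ[ℝ] E n))
  have : Finite Q := by
    have := hΓ.finite_map_linearHom
    exact Finite.of_injective _ (Subgroup.inclusion_injective
      (Subgroup.map_mono (f := AffineEquiv.linearHom) (Subgroup.map_subtype_le N)))
  let _ : Fintype Q := Fintype.ofFinite Q
  refine ⟨Fintype.card Q, Fintype.card_ne_zero, fun v hv => ?_⟩
  refine ⟨∑ q : Q, (v - q.1 v), ?_, fun ν hν => ?_⟩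
  · refine Submodule.sum_mem _ fun q _ => ?_
    obtain ⟨_, _, ⟨ν, hν, rfl⟩, rfl⟩ := q
    change transl (v - lin n ν.1 v) ∈ N.map Γ.subtype
    let τ : Γ := ⟨transl v, hv⟩
    have e : transl (v - lin n ν.1 v) = (τ * ν * τ⁻¹ * ν⁻¹ : Γ).1 := by
      change _ = transl v * ν.1 * (transl v)⁻¹ * ν.1⁻¹
      rw [conj_transl_eq, mul_inv_cancel_right]
    rw [e]
    exact ⟨_, N.mul_mem (Subgroup.Normal.conj_mem inferInstance ν hν τ) (N.inv_mem hν), rfl⟩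
  · rw [conj_transl_eq, conj_transl_eq]
    congr 2
    have h : lin n ν.1 (∑ q : Q, q.1 v) = ∑ q : Q, q.1 v := by
      rw [map_sum]
      conv_rhs => rw [← Equiv.sum_comp (Equiv.mulLeft (⟨_, _, ⟨ν, hν, rfl⟩, rfl⟩ : Q))]
      rfl
    rw [Finset.sum_sub_distrib, map_sub, h, Finset.sum_const, Finset.card_univ]
    abel

theorem IsSpaceGroup.finite_quotient_translations (hΓ : IsSpaceGroup Γ) {r : ℕ} (hr : r ≠ 0) :
    ∃ S : Set (E n), S.Finite ∧ S ⊆ translations Γ ∧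
      ∀ v ∈ translations Γ, ∃ w ∈ S, ∃ u ∈ translations Γ, v = w + r • u := by
  let _ := hΓ.discreteTopology_translations
  have := hΓ.isZLattice_translations
  have : Module.Finite ℤ (translations Γ) := ZLattice.module_finite ℝ _
  let I := LinearMap.range (LinearMap.lsmul ℤ (translations Γ) (r : ℤ))
  have : Finite (translations Γ ⧸ I) := by
    refine Module.finite_of_fg_torsion _ fun x => ?_
    refine ⟨⟨(r : ℤ), mem_nonZeroDivisors_of_ne_zero (Nat.cast_ne_zero.2 hr)⟩, ?_⟩
    induction x using Submodule.Quotient.induction_on with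
    | H v => exact (Submodule.Quotient.mk_eq_zero I).2 ⟨v, rfl⟩
  refine ⟨Set.range fun x : translations Γ ⧸ I => (x.out : E n), Set.finite_range _, ?_, ?_⟩
  · rintro _ ⟨x, rfl⟩
    exact x.out.2
  · intro v hv
    refine ⟨_, ⟨Submodule.Quotient.mk ⟨v, hv⟩, rfl⟩, ?_⟩
    have h : Submodule.Quotient.mk (p := I) ⟨v, hv⟩ =
        Submodule.Quotient.mk (Quotient.out (Submodule.Quotient.mk (p := I) ⟨v, hv⟩)) :=
      (Quotient.out_eq _).symm
    obtain ⟨u, hu⟩ := (Submodule.Quotient.eq I).1 h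
    refine ⟨u.1, u.2, ?_⟩
    have hu := congrArg Subtype.val hu
    exact sub_eq_iff_eq_add'.1 (hu.symm.trans (natCast_zsmul u.1 r))

/-- A space group acts on each of its normal subgroups by finitely many outer automorphisms. -/
theorem IsSpaceGroup.finite_range_conjOut (hΓ : IsSpaceGroup Γ) (N : Subgroup Γ) [N.Normal] :
    (Set.range (conjOut N)).Finite := by
  obtain ⟨r, hr, hs⟩ := hΓ.exists_conj_smul_eq_conj N
  obtain ⟨S, hSf, hS, hSr⟩ := hΓ.finite_quotient_translations hr
  let φ : Γ →* Out N := (conjOut N).comp (QuotientGroup.mk' N)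
  -- Translations by `r`-fold lattice vectors act on `N` by inner automorphisms. They have finite
  -- index in the lattice, and the lattice has finite index in `Γ`.
  have hφr : ∀ v (hv : v ∈ translations Γ),
      φ ⟨transl (r • v), (translations Γ).smul_of_tower_mem r hv⟩ = 1 := fun v hv => by
    obtain ⟨s, ⟨σ, hσ, hσs⟩, h⟩ := hs v hv
    refine (QuotientGroup.eq_one_iff _).2 ⟨⟨σ, hσ⟩, ?_⟩
    ext ν : 3
    have e : σ.1 = transl s := hσs
    change σ.1 * ν.1.1 * σ.1⁻¹ = transl (r • v) * ν.1.1 * (transl (r • v))⁻¹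
    rw [e, h ν.1 ν.2]
  have hφT : (φ '' {γ | lin n γ.1 = 1}).Finite := by
    have : (φ '' {γ | γ.1 ∈ transl '' S}).Finite := by
      refine Set.Finite.image _ (Set.Finite.of_finite_image ((hSf.image transl).subset ?_)
        Subtype.val_injective.injOn)
      rintro _ ⟨γ, h, rfl⟩
      exact h
    refine this.subset ?_
    rintro _ ⟨γ, hγ, rfl⟩
    have e := eq_transl_of_lin_eq_one hγ
    have hT : γ.1 0 ∈ translations Γ := by
      rw [mem_translations, ← e]
      exact γ.2
    obtain ⟨w, hw, u, hu, huw⟩ := hSr _ hT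
    refine ⟨⟨transl w, hS hw⟩, ⟨w, hw, rfl⟩, ?_⟩
    have : γ = ⟨transl w, hS hw⟩ *
        ⟨transl (r • u), (translations Γ).smul_of_tower_mem r hu⟩ := by
      refine Subtype.ext ?_
      change γ.1 = transl w * transl (r • u)
      rw [e, huw, transl_mul]
    rw [this, map_mul, hφr u hu, mul_one]
  have hQ := hΓ.finite_map_linearHom
  have hsurj : ∀ A : Γ.map (AffineEquiv.linearHom : Aff n →* (E n ≃ₗ[ℝ] E n)),
      ∃ γ : Γ, AffineEquiv.linearHom γ.1 = A.1 := by
    rintro ⟨_, γ, hγ, rfl⟩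
    exact ⟨⟨γ, hγ⟩, rfl⟩
  choose c hcs using hsurj
  refine ((Set.finite_range (φ ∘ c)).mul hφT).subset ?_
  rintro _ ⟨x, rfl⟩
  induction x using QuotientGroup.induction_on with
  | H γ =>
    let A : Γ.map (AffineEquiv.linearHom : Aff n →* (E n ≃ₗ[ℝ] E n)) := ⟨_, γ.1, γ.2, rfl⟩
    refine ⟨φ (c A), ⟨A, rfl⟩, φ ((c A)⁻¹ * γ), ⟨_, ?_, rfl⟩, ?_⟩
    · change lin n ((c A)⁻¹ * γ).1 = 1
      rw [← linearHom_eq_one_iff]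
      change AffineEquiv.linearHom ((c A).1⁻¹ * γ.1) = 1
      rw [map_mul, map_inv, hcs, inv_mul_cancel]
    · change φ (c A) * φ ((c A)⁻¹ * γ) = φ γ
      rw [← map_mul, mul_inv_cancel_left]

end FiniteOut

/-! ### The outer action as an invariant of pairs -/

section Omega

variable {m k : ℕ} {Δ : Subgroup (Aff k)} {M : Subgroup (Aff m)}

/-- The homomorphism `α_# 𝒪 β : Δ → Out(M)`. -/
abbrev Pair.outHom (p : Pair Δ M) (α : p.N ≃* M) (β : Δ ≃* p.Γ ⧸ p.N) : Δ →* Out M :=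
  ((outCongr α).toMonoidHom.comp (conjOut p.N)).comp β.toMonoidHom

theorem Pair.finite_range_outHom (p : Pair Δ M) (α : p.N ≃* M) (β : Δ ≃* p.Γ ⧸ p.N) :
    (Set.range (p.outHom α β)).Finite := by
  refine ((p.spaceGroup.finite_range_conjOut p.N).image (outCongr α)).subset ?_
  rintro _ ⟨δ, rfl⟩
  exact ⟨_, ⟨β δ, rfl⟩, rfl⟩

/-- This makes ω well defined; the identity isomorphism of one pair gives independence of `α` and
`β`. -/
theorem Pair.sameOrbit_outHom {p q : Pair Δ M} (h : p.Iso q) (α : p.N ≃* M)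
    (β : Δ ≃* p.Γ ⧸ p.N) (α' : q.N ≃* M) (β' : Δ ≃* q.Γ ⧸ q.N) :
    SameOrbit (p.outHom α β) (q.outHom α' β') := by
  obtain ⟨φ, hφ⟩ := h
  let A : MulAut M := (α.symm.trans (restrictEquiv φ hφ)).trans α'
  let Q := QuotientGroup.congr p.N q.N φ hφ
  refine ⟨QuotientGroup.mk A, (β'.trans Q.symm).trans β.symm, fun δ => ?_⟩
  change outCongr α' (conjOut q.N (β' δ)) = QuotientGroup.mk A *
    outCongr α (conjOut p.N (β (β.symm (Q.symm (β' δ))))) * (QuotientGroup.mk A)⁻¹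
  rw [MulEquiv.apply_symm_apply, ← outCongr_mulAut, ← outCongr_trans]
  obtain ⟨x, hx⟩ := Q.surjective (β' δ)
  rw [← hx, MulEquiv.symm_apply_apply, ← outCongr_restrictEquiv_conjOut, ← outCongr_trans]
  congr 2
  ext y
  simp [A]

theorem Pair.iso_of_sameOrbit (hc : Subgroup.center M = ⊥) {p q : Pair Δ M} (α : p.N ≃* M)
    (β : Δ ≃* p.Γ ⧸ p.N) (α' : q.N ≃* M) (β' : Δ ≃* q.Γ ⧸ q.N)
    (h : SameOrbit (p.outHom α β) (q.outHom α' β')) : p.Iso q := by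
  obtain ⟨a, ζ, h⟩ := h
  induction a using QuotientGroup.induction_on with
  | H A =>
    refine exists_equiv_of_conjOut (center_eq_bot_of_equiv α hc) (center_eq_bot_of_equiv α' hc)
      ((α.trans A).trans α'.symm) ((β.symm.trans ζ.symm).trans β') fun x => ?_
    obtain ⟨δ, rfl⟩ := (ζ.trans β).surjective x
    have h1 := h δ
    change outCongr α' (conjOut q.N (β' δ)) = QuotientGroup.mk A *
      outCongr α (conjOut p.N (β (ζ δ))) * (QuotientGroup.mk A)⁻¹ at h1
    rw [← outCongr_mulAut, ← outCongr_trans] at h1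
    rw [outCongr_trans]
    change outCongr α'.symm (outCongr (α.trans A) (conjOut p.N (β (ζ δ)))) =
      conjOut q.N (β' (ζ.symm (β.symm (β (ζ δ)))))
    rw [← h1, ← outCongr_trans, MulEquiv.symm_apply_apply, MulEquiv.symm_apply_apply,
      MulEquiv.self_trans_symm]
    generalize conjOut q.N (β' δ) = z
    induction z using QuotientGroup.induction_on with
    | H ζ => rfl

end Omega

/-! ### Products of affinities -/

section Products

variable {m k : ℕ}

/-- The point of `E^(m+k) = Eᵐ × Eᵏ` with the given components. -/
def pt (z : E m × E k) : E (m + k) :=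
  (EuclideanSpace.finAddEquivProd (𝕜 := ℝ) (n := m) (m := k)).symm z

theorem pt_surjective : Function.Surjective (pt (m := m) (k := k)) :=
  (EuclideanSpace.finAddEquivProd (𝕜 := ℝ) (n := m) (m := k)).symm.surjective

theorem pt_injective : Function.Injective (pt (m := m) (k := k)) :=
  (EuclideanSpace.finAddEquivProd (𝕜 := ℝ) (n := m) (m := k)).symm.injective

theorem pt_add (z w : E m × E k) : pt (z + w) = pt z + pt w := map_add _ z w

theorem pt_sub (z w : E m × E k) : pt (z - w) = pt z - pt w := map_sub _ z w

theorem pt_smul (c : ℝ) (z : E m × E k) : pt (c • z) = c • pt z := map_smul _ c z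

theorem pt_zero : pt (0 : E m × E k) = 0 := map_zero _

theorem inner_pt (z w : E m × E k) :
    Inner.inner ℝ (pt z) (pt w) = (Inner.inner ℝ z.1 w.1 + Inner.inner ℝ z.2 w.2 : ℝ) := by
  simp only [PiLp.inner_apply, Fin.sum_univ_add]
  simp [pt, EuclideanSpace.finAddEquivProd]

theorem norm_pt_sq (z : E m × E k) : ‖pt z‖ ^ 2 = ‖z.1‖ ^ 2 + ‖z.2‖ ^ 2 := by
  rw [← real_inner_self_eq_norm_sq, inner_pt, real_inner_self_eq_norm_sq,
    real_inner_self_eq_norm_sq]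

theorem norm_fst_le_norm_pt (z : E m × E k) : ‖z.1‖ ≤ ‖pt z‖ := by
  refine le_of_sq_le_sq ?_ (norm_nonneg _)
  rw [norm_pt_sq]
  exact le_add_of_nonneg_right (sq_nonneg _)

theorem norm_snd_le_norm_pt (z : E m × E k) : ‖z.2‖ ≤ ‖pt z‖ := by
  refine le_of_sq_le_sq ?_ (norm_nonneg _)
  rw [norm_pt_sq]
  exact le_add_of_nonneg_left (sq_nonneg _)

theorem norm_pt_le (z : E m × E k) : ‖pt z‖ ≤ ‖z.1‖ + ‖z.2‖ := by
  refine le_of_sq_le_sq ?_ (by positivity)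
  rw [norm_pt_sq]
  nlinarith [norm_nonneg z.1, norm_nonneg z.2]

theorem prodAff_pt (α : Aff m) (δ : Aff k) (z : E m × E k) :
    prodAff α δ (pt z) = pt (α z.1, δ z.2) := by
  let e := EuclideanSpace.finAddEquivProd (𝕜 := ℝ) (n := m) (m := k)
  change e.symm (α (e (e.symm z)).1, δ (e (e.symm z)).2) = _
  rw [e.apply_symm_apply]
  rfl

theorem prodAff_zero (α : Aff m) (δ : Aff k) : prodAff α δ 0 = pt (α 0, δ 0) := by
  rw [← pt_zero, prodAff_pt]
  rfl

theorem lin_prodAff_pt (α : Aff m) (δ : Aff k) (z : E m × E k) :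
    lin (m + k) (prodAff α δ) (pt z) = pt (lin m α z.1, lin k δ z.2) := by
  have h := aff_apply (prodAff α δ) (pt z)
  rw [← sub_eq_iff_eq_add, prodAff_pt, prodAff_zero, ← pt_sub] at h
  rw [← h, aff_apply α z.1, aff_apply δ z.2, Prod.mk_sub_mk, add_sub_cancel_right,
    add_sub_cancel_right]

theorem prodAff_mul (α α' : Aff m) (δ δ' : Aff k) :
    prodAff α δ * prodAff α' δ' = prodAff (α * α') (δ * δ') := by
  ext1 x
  obtain ⟨z, rfl⟩ := pt_surjective x
  rw [aff_mul_apply, prodAff_pt, prodAff_pt, prodAff_pt]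
  rfl

theorem prodAff_one : prodAff (1 : Aff m) (1 : Aff k) = 1 := by
  ext1 x
  obtain ⟨z, rfl⟩ := pt_surjective x
  rw [prodAff_pt]
  rfl

theorem prodAff_inv (α : Aff m) (δ : Aff k) : (prodAff α δ)⁻¹ = prodAff α⁻¹ δ⁻¹ := by
  rw [inv_eq_iff_mul_eq_one, prodAff_mul, mul_inv_cancel, mul_inv_cancel, prodAff_one]

theorem prodAff_inj {α α' : Aff m} {δ δ' : Aff k} :
    prodAff α δ = prodAff α' δ' ↔ α = α' ∧ δ = δ' := by
  refine ⟨fun h => ?_, fun h => by rw [h.1, h.2]⟩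
  have key : ∀ z : E m × E k, (α z.1, δ z.2) = (α' z.1, δ' z.2) := fun z => by
    apply pt_injective
    rw [← prodAff_pt, ← prodAff_pt, h]
  constructor
  · ext1 x
    exact congrArg Prod.fst (key (x, 0))
  · ext1 y
    exact congrArg Prod.snd (key (0, y))

theorem isometry_prodAff {α : Aff m} {δ : Aff k} (hα : Isometry α) (hδ : Isometry δ) :
    Isometry (prodAff α δ) := by
  refine isometry_of_norm_lin fun x => ?_
  obtain ⟨z, rfl⟩ := pt_surjective x
  refine (pow_left_inj₀ (norm_nonneg _) (norm_nonneg _) two_ne_zero).1 ?_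
  rw [lin_prodAff_pt, norm_pt_sq, norm_pt_sq, norm_lin_apply hα, norm_lin_apply hδ]

/-- The homomorphism `μ ↦ μ × 1`. -/
def extendAff (m k : ℕ) : Aff m →* Aff (m + k) where
  toFun μ := prodAff μ 1
  map_one' := prodAff_one
  map_mul' μ μ' := by rw [prodAff_mul, one_mul]

variable {Δ : Subgroup (Aff k)} {M : Subgroup (Aff m)} {Γ : Subgroup (Aff (m + k))}
  {N : Subgroup Γ}

theorem exists_equiv_extension
    (hN : ∀ γ : Aff (m + k), (∃ h : γ ∈ Γ, (⟨γ, h⟩ : Γ) ∈ N) ↔ ∃ μ ∈ M, γ = prodAff μ 1) :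
    ∃ e : M ≃* N, ∀ μ, (e μ).1.1 = prodAff μ.1 1 := by
  have h : ∀ μ : M, ∃ h : prodAff μ.1 1 ∈ Γ, (⟨_, h⟩ : Γ) ∈ N := fun μ => (hN _).2 ⟨μ.1, μ.2, rfl⟩
  let f : M →* N := MonoidHom.mk' (fun μ => ⟨⟨_, (h μ).1⟩, (h μ).2⟩) fun μ μ' =>
    Subtype.ext (Subtype.ext ((extendAff m k).map_mul μ.1 μ'.1))
  refine ⟨MulEquiv.ofBijective f ⟨fun μ μ' e => ?_, ?_⟩, fun μ => rfl⟩
  · have : prodAff μ.1 (1 : Aff k) = prodAff μ'.1 1 := congrArg (fun ν : N => ν.1.1) e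
    exact Subtype.ext (prodAff_inj.1 this).1
  · rintro ⟨⟨γ, hγ⟩, hγN⟩
    obtain ⟨μ, hμ, rfl⟩ := (hN γ).1 ⟨hγ, hγN⟩
    exact ⟨⟨μ, hμ⟩, rfl⟩

/-- Two elements of `Γ` over the same `δ` differ by one over 1, which `hk` and `hN` place in `N`;
hence `δ` determines a coset. -/
theorem exists_equiv_quotient [N.Normal]
    (hN : ∀ γ : Aff (m + k), (∃ h : γ ∈ Γ, (⟨γ, h⟩ : Γ) ∈ N) ↔ ∃ μ ∈ M, γ = prodAff μ 1)
    (hs : ∀ γ ∈ Γ, ∃ (α : Aff m) (δ : Aff k), γ = prodAff α δ)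
    (hb : ∀ δ : Aff k, δ ∈ Δ ↔ ∃ α : Aff m, prodAff α δ ∈ Γ)
    (hk : ∀ α : Aff m, prodAff α 1 ∈ Γ → α ∈ M) :
    ∃ β : Δ ≃* Γ ⧸ N, ∀ (α : Aff m) (δ : Δ) (h : prodAff α δ.1 ∈ Γ),
      β δ = (⟨_, h⟩ : Γ) := by
  choose a ha using fun δ : Δ => (hb δ.1).1 δ.2
  have hu : ∀ (α α' : Aff m) (δ : Aff k) (h : prodAff α δ ∈ Γ) (h' : prodAff α' δ ∈ Γ),
      ((⟨_, h⟩ : Γ) : Γ ⧸ N) = (⟨_, h'⟩ : Γ) := fun α α' δ h h' => by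
    rw [QuotientGroup.eq]
    have e : (prodAff α δ)⁻¹ * prodAff α' δ = prodAff (α⁻¹ * α') 1 := by
      rw [prodAff_inv, prodAff_mul, inv_mul_cancel]
    have hm : prodAff (α⁻¹ * α') (1 : Aff k) ∈ Γ := e ▸ Γ.mul_mem (Γ.inv_mem h) h'
    exact ((hN _).2 ⟨_, hk _ hm, e⟩).2
  let f : Δ →* Γ ⧸ N := MonoidHom.mk' (fun δ => (⟨_, ha δ⟩ : Γ)) fun δ δ' => by
    rw [← QuotientGroup.mk_mul]
    have e : prodAff (a δ) δ.1 * prodAff (a δ') δ'.1 = prodAff (a δ * a δ') (δ * δ' : Δ).1 :=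
      prodAff_mul _ _ _ _
    have hm : prodAff (a δ * a δ') (δ * δ' : Δ).1 ∈ Γ := e ▸ Γ.mul_mem (ha δ) (ha δ')
    rw [hu _ _ _ (ha (δ * δ')) hm]
    exact congrArg _ (Subtype.ext e.symm)
  refine ⟨MulEquiv.ofBijective f ⟨?_, ?_⟩, fun α δ h => hu _ _ _ _ _⟩
  · rw [injective_iff_map_eq_one]
    intro δ hδ
    obtain ⟨μ, -, hμ⟩ := (hN _).1 ⟨_, (QuotientGroup.eq_one_iff _).1 hδ⟩
    exact Subtype.ext (prodAff_inj.1 hμ).2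
  · intro q
    induction q using QuotientGroup.induction_on with
    | H γ =>
      obtain ⟨γ, hγ⟩ := γ
      obtain ⟨α, δ, rfl⟩ := hs γ hγ
      exact ⟨⟨δ, (hb δ).2 ⟨α, hγ⟩⟩, hu _ _ _ _ _⟩

end Products

/-! ### The outer action of a pair arising from a homomorphism -/

section Arises

variable {m k : ℕ} {Δ : Subgroup (Aff k)} {M : Subgroup (Aff m)}

theorem mem_conj {φ g : Aff m} : g ∈ conj φ M ↔ ∃ μ ∈ M, g = φ * μ * φ⁻¹ := by
  constructor
  · rintro ⟨μ, hμ, rfl⟩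
    exact ⟨μ, hμ, rfl⟩
  · rintro ⟨μ, hμ, rfl⟩
    exact ⟨μ, hμ, rfl⟩

theorem IsLift.sharp {β : Equiv.Perm (Orb M)} {g : Aff m} (h : IsLift β g) (φ : Aff m) :
    IsLift (sharp φ M β) (φ * g * φ⁻¹) := fun x => by
  obtain ⟨y, rfl⟩ := φ.surjective x
  change star φ M (β ((star φ M).symm (star φ M (orb M y)))) = _
  rw [Equiv.symm_apply_apply, h, star_orb]
  exact congrArg (fun z => orb (conj φ M) (φ (g z))) (aff_inv_apply_self φ y).symm

theorem isLift_of_sharp {β : Equiv.Perm (Orb M)} {g φ : Aff m}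
    (h : IsLift (FlatOrbifold.sharp φ M β) g) : IsLift β (φ⁻¹ * g * φ) := fun x => by
  have h1 := h (φ x)
  change star φ M (β ((star φ M).symm (star φ M (orb M x)))) = _ at h1
  rw [Equiv.symm_apply_apply] at h1
  apply (star φ M).injective
  rw [h1, star_orb]
  exact congrArg (orb (conj φ M)) (aff_apply_inv_self φ _).symm

theorem IsSpaceGroup.mem_of_isLift_one (hM : IsSpaceGroup M) {g : Aff m}
    (h : IsLift (1 : Equiv.Perm (Orb M)) g) : g ∈ M := by
  obtain ⟨γ, hγ, e⟩ := hM.exists_eq_mul (g := g) (h := 1) fun x => (h x).symm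
  rw [e, mul_one]
  exact hγ

theorem ArisesVia.isLift {η : Δ →* affOrb M} {p : Pair Δ M} {C : E m ≃ₗ[ℝ] E m}
    (h : ArisesVia η p C) {α : Aff m} {δ : Δ} (hα : prodAff α δ.1 ∈ p.Γ) :
    IsLift (η δ).1 (C.toAffineEquiv⁻¹ * α * C.toAffineEquiv) :=
  isLift_of_sharp (h.action α δ hα)

theorem ArisesVia.mem_of_prodAff_one_mem (hM : IsSpaceGroup M) {η : Δ →* affOrb M} {p : Pair Δ M}
    {C : E m ≃ₗ[ℝ] E m} (h : ArisesVia η p C) {α : Aff m} (hα : prodAff α 1 ∈ p.Γ) :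
    α ∈ conj C.toAffineEquiv M := by
  have h1 := h.isLift (δ := 1) hα
  rw [map_one] at h1
  exact mem_conj.2 ⟨_, hM.mem_of_isLift_one h1, by group⟩

/-- The triangle ω ∘ ψ = `omegaComp` at the level of homomorphisms. With `N` identified with `M`
through `C`, conjugation by `prodAff a δ` becomes conjugation by `C⁻¹ a C`, a lift of `η δ`. -/
theorem Arises.exists_outHom_eq (hM : IsSpaceGroup M) {η : Δ →* affOrb M} {p : Pair Δ M}
    (h : Arises η p) : ∃ (α : p.N ≃* M) (β : Δ ≃* p.Γ ⧸ p.N),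
      p.outHom α β = (Omega hM).comp η := by
  obtain ⟨C, h⟩ := h
  obtain ⟨e, he⟩ := exists_equiv_extension h.extension
  obtain ⟨β, hβ⟩ := exists_equiv_quotient h.extension h.splits h.base
    (fun _ => h.mem_of_prodAff_one_mem hM)
  let c : M ≃* conj C.toAffineEquiv M :=
    M.equivMapOfInjective _ (MulAut.conj C.toAffineEquiv).injective
  have hce : ∀ μ, (e (c μ)).1.1 =
      prodAff (C.toAffineEquiv * μ.1 * C.toAffineEquiv⁻¹) 1 := fun μ => he (c μ)
  refine ⟨(c.trans e).symm, β, ?_⟩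
  ext1 δ
  obtain ⟨a, ha⟩ := (h.base δ.1).1 δ.2
  have hl := h.isLift ha
  change outCongr (c.trans e).symm (conjOut p.N (β δ)) = Omega hM (η δ)
  rw [hβ a δ ha, conjOut_mk, outCongr_mk, Omega_apply hM _ hl]
  refine congrArg (QuotientGroup.mk : MulAut M → Out M) ?_
  ext1 μ
  rw [MulEquiv.trans_apply, MulEquiv.trans_apply, MulEquiv.symm_apply_eq, MulEquiv.symm_symm]
  refine Subtype.ext (Subtype.ext ?_)
  rw [MulAut.conjNormal_apply]
  change prodAff a δ.1 * (e (c μ)).1.1 * (prodAff a δ.1)⁻¹ = (e (c _)).1.1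
  rw [hce, hce, prodAff_inv, prodAff_mul, prodAff_mul, mul_one, mul_inv_cancel]
  congr 1
  change _ = C.toAffineEquiv * (C.toAffineEquiv⁻¹ * a * C.toAffineEquiv * μ.1 *
    (C.toAffineEquiv⁻¹ * a * C.toAffineEquiv)⁻¹) * C.toAffineEquiv⁻¹
  group

end Arises

/-! ### Invariant inner products and isometries of orbit spaces -/

section Invariant

variable {m : ℕ} {M : Subgroup (Aff m)}

/-- A finite group of linear automorphisms is conjugate to a group of isometries. -/
theorem exists_norm_invariant (Q : Subgroup (E m ≃ₗ[ℝ] E m)) [Finite Q] :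
    ∃ C : E m ≃ₗ[ℝ] E m, ∀ q ∈ Q, ∀ x, ‖C (q x)‖ = ‖C x‖ := by
  let _ : Fintype Q := Fintype.ofFinite Q
  -- The norm of `J x = (q x)_q` is the `Q`-invariant averaged norm; an orthonormal basis of the
  -- range of `J` carries it to the standard norm.
  let J : E m →ₗ[ℝ] PiLp 2 (fun _ : Q => E m) :=
    (WithLp.linearEquiv 2 ℝ (Q → E m)).symm.toLinearMap ∘ₗ
      LinearMap.pi fun q => (q.1 : E m →ₗ[ℝ] E m)
  have hJ : ∀ x (q : Q), J x q = q.1 x := fun _ _ => rfl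
  have hJi : Function.Injective J := fun x y h => by
    have := congrArg (fun z => z (1 : Q)) h
    rw [hJ, hJ] at this
    exact this
  have hr : Module.finrank ℝ (LinearMap.range J) = m := by
    rw [LinearMap.finrank_range_of_inj hJi, finrank_euclideanSpace_fin]
  let I : LinearMap.range J ≃ₗᵢ[ℝ] E m :=
    ((stdOrthonormalBasis ℝ (LinearMap.range J)).reindex (finCongr hr)).repr
  have hC : ∀ x, ‖I (LinearEquiv.ofInjective J hJi x)‖ ^ 2 = ∑ q : Q, ‖q.1 x‖ ^ 2 := fun x => by
    rw [LinearIsometryEquiv.norm_map]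
    exact PiLp.norm_sq_eq_of_L2 _ (J x)
  refine ⟨(LinearEquiv.ofInjective J hJi).trans I.toLinearEquiv, fun q hq x => ?_⟩
  refine (pow_left_inj₀ (norm_nonneg _) (norm_nonneg _) two_ne_zero).1 ?_
  refine (hC (q x)).trans (Eq.trans ?_ (hC x).symm)
  exact Equiv.sum_comp (Equiv.mulRight (⟨q, hq⟩ : Q)) fun q => ‖q.1 x‖ ^ 2

theorem IsLift.mem_isomOrb {β : Equiv.Perm (Orb M)} {g : Aff m} (h : IsLift β g)
    (hg : Isometry g) : β ∈ isomOrb M := by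
  have key : ∀ {β : Equiv.Perm (Orb M)} {g : Aff m}, IsLift β g → Isometry g → ∀ p q,
      {r | ∃ x y, orb M x = p ∧ orb M y = q ∧ r = dist x y} ⊆
        {r | ∃ x y, orb M x = β p ∧ orb M y = β q ∧ r = dist x y} := by
    rintro β g h hg p q _ ⟨x, y, rfl, rfl, rfl⟩
    exact ⟨g x, g y, (h x).symm, (h y).symm, (hg.dist_eq x y).symm⟩
  intro p q
  refine congrArg sInf (Set.Subset.antisymm ?_ (key h hg p q))
  have := key h.inv (isometry_inv hg) (β p) (β q)
  have e : ∀ r, β⁻¹ (β r) = r := β.symm_apply_apply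
  rwa [e, e] at this

theorem IsSpaceGroup.exists_mul_of_isLift (hM : IsSpaceGroup M) {β : Equiv.Perm (Orb M)}
    {g g' : Aff m} (h : IsLift β g) (h' : IsLift β g') : ∃ μ ∈ M, g = μ * g' :=
  hM.exists_eq_mul fun x => (h x).symm.trans (h' x)

/-- Discreteness and cocompactness survive a linear change of coordinates, which distorts norms by
bounded factors; only isometry has to be assumed. -/
theorem IsSpaceGroup.conj (hM : IsSpaceGroup M) (C : E m ≃ₗ[ℝ] E m)
    (hC : ∀ μ ∈ M, Isometry (C.toAffineEquiv * μ * C.toAffineEquiv⁻¹ : Aff m)) :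
    IsSpaceGroup (conj C.toAffineEquiv M) := by
  let L : E m →L[ℝ] E m := LinearMap.toContinuousLinearMap (C : E m →ₗ[ℝ] E m)
  let L' : E m →L[ℝ] E m := LinearMap.toContinuousLinearMap (C.symm : E m →ₗ[ℝ] E m)
  have hL : ∀ x, C.toAffineEquiv x = L x := fun _ => rfl
  have hL' : ∀ x, C.toAffineEquiv⁻¹ x = L' x := fun _ => rfl
  have hL'L : ∀ x, L' (L x) = x := fun x => C.symm_apply_apply x
  refine IsSpaceGroup.of_norm ?_ (fun R => ?_) ?_
  · intro g hg
    obtain ⟨μ, hμ, rfl⟩ := mem_conj.1 hg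
    exact hC μ hμ
  · refine ((hM.finite_norm_le (‖L'‖ * R)).image
      fun μ => C.toAffineEquiv * μ * C.toAffineEquiv⁻¹).subset ?_
    rintro g ⟨hg, hR⟩
    obtain ⟨μ, hμ, rfl⟩ := mem_conj.1 hg
    refine ⟨μ, ⟨hμ, ?_⟩, rfl⟩
    rw [aff_mul_apply, aff_mul_apply, hL, hL', map_zero] at hR
    rw [← hL'L (μ 0)]
    exact (L'.le_opNorm _).trans (mul_le_mul_of_nonneg_left hR (norm_nonneg _))
  · obtain ⟨R, hR⟩ := hM.exists_norm_le
    refine ⟨‖L‖ * R, fun x => ?_⟩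
    obtain ⟨μ, hμ, h⟩ := hR (L' x)
    refine ⟨_, mem_conj.2 ⟨μ, hμ, rfl⟩, ?_⟩
    rw [aff_mul_apply, aff_mul_apply, hL, hL']
    exact (L.le_opNorm _).trans (mul_le_mul_of_nonneg_left h (norm_nonneg _))

/-- The group of all affinities lifting an element of a group of affinities of the orbit space. -/
def lifts (H : Subgroup (Equiv.Perm (Orb M))) : Subgroup (Aff m) where
  carrier := {g | ∃ β ∈ H, IsLift β g}
  one_mem' := ⟨1, H.one_mem, fun _ => rfl⟩
  mul_mem' := by
    rintro g g' ⟨β, hβ, h⟩ ⟨β', hβ', h'⟩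
    exact ⟨_, H.mul_mem hβ hβ', h.mul h'⟩
  inv_mem' := by
    rintro g ⟨β, hβ, h⟩
    exact ⟨_, H.inv_mem hβ, h.inv⟩

/-- Lifts of one `β` differ by elements of `M`, so the linear parts fill finitely many cosets of the
finite point group of `M`. -/
theorem IsSpaceGroup.finite_map_linearHom_lifts (hM : IsSpaceGroup M)
    (H : Subgroup (Equiv.Perm (Orb M))) [Finite H] :
    Finite ((lifts H).map (AffineEquiv.linearHom : Aff m →* (E m ≃ₗ[ℝ] E m))) := by
  have hfin := hM.finite_map_linearHom
  let s : Set (Equiv.Perm (Orb M)) := {β | β ∈ H ∧ ∃ g : Aff m, IsLift β g}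
  have hs : s.Finite := (Set.toFinite (H : Set (Equiv.Perm (Orb M)))).subset fun β h => h.1
  have : Finite s := hs
  choose f hf using fun β : s => β.2.2
  have h1 : (Set.image2 (· * ·)
      (M.map (AffineEquiv.linearHom : Aff m →* (E m ≃ₗ[ℝ] E m)) : Set (E m ≃ₗ[ℝ] E m))
      (Set.range fun β : s => (AffineEquiv.linearHom (f β) : E m ≃ₗ[ℝ] E m))).Finite :=
    Set.Finite.image2 _ hfin (Set.finite_range _)
  refine Set.Finite.subset h1 ?_
  rintro _ ⟨g, ⟨β, hβ, h⟩, rfl⟩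
  obtain ⟨μ, hμ, e⟩ := hM.exists_mul_of_isLift h (hf ⟨β, hβ, g, h⟩)
  refine ⟨_, ⟨μ, hμ, rfl⟩, _, ⟨⟨β, hβ, g, h⟩, rfl⟩, ?_⟩
  change AffineEquiv.linearHom μ * AffineEquiv.linearHom _ = _
  rw [← map_mul, ← e]

/-- A finite group of affinities of an orbit space is conjugate to a group of isometries. -/
theorem IsSpaceGroup.exists_isometry_conj (hM : IsSpaceGroup M)
    (H : Subgroup (Equiv.Perm (Orb M))) [Finite H] :
    ∃ C : E m ≃ₗ[ℝ] E m, ∀ β ∈ H, ∀ g : Aff m, IsLift β g →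
      Isometry (C.toAffineEquiv * g * C.toAffineEquiv⁻¹ : Aff m) := by
  have := hM.finite_map_linearHom_lifts H
  obtain ⟨C, hC⟩ := exists_norm_invariant
    ((lifts H).map (AffineEquiv.linearHom : Aff m →* (E m ≃ₗ[ℝ] E m)))
  refine ⟨C, fun β hβ g h => isometry_of_norm_lin fun x => ?_⟩
  have h1 := hC _ ⟨g, ⟨β, hβ, h⟩, rfl⟩ (C.symm x)
  rw [LinearEquiv.apply_symm_apply] at h1
  exact h1

end Invariant

/-! ### The construction of a pair -/

section Construction

variable {m k : ℕ} {Δ : Subgroup (Aff k)} {M : Subgroup (Aff m)}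

/-- The group of all `φ g φ⁻¹ × δ`, where `g` lifts `η(δ)`. -/
def fiberGroup (η : Δ →* affOrb M) (φ : Aff m) : Subgroup (Aff (m + k)) where
  carrier := {γ | ∃ (g : Aff m) (δ : Δ), IsLift (η δ).1 g ∧ γ = prodAff (φ * g * φ⁻¹) δ.1}
  one_mem' := ⟨1, 1, by rw [map_one]; exact fun _ => rfl, by
    rw [mul_one, mul_inv_cancel]; exact prodAff_one.symm⟩
  mul_mem' := by
    rintro _ _ ⟨g, δ, h, rfl⟩ ⟨g', δ', h', rfl⟩
    refine ⟨g * g', δ * δ', by rw [map_mul]; exact h.mul h', ?_⟩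
    rw [prodAff_mul]
    congr 1
    group
  inv_mem' := by
    rintro _ ⟨g, δ, h, rfl⟩
    refine ⟨g⁻¹, δ⁻¹, by rw [map_inv]; exact h.inv, ?_⟩
    rw [prodAff_inv]
    exact congrArg (fun α => prodAff α _) (by group)

theorem prodAff_mem_fiberGroup {η : Δ →* affOrb M} {φ : Aff m} {α : Aff m} {δ : Δ} :
    prodAff α δ.1 ∈ fiberGroup η φ ↔ IsLift (η δ).1 (φ⁻¹ * α * φ) := by
  constructor
  · rintro ⟨g, δ', h, e⟩
    obtain ⟨rfl, e'⟩ := prodAff_inj.1 e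
    obtain rfl := Subtype.ext e'
    convert! h using 1
    group
  · intro h
    exact ⟨_, δ, h, by congr 1; group⟩

theorem exists_prodAff_mem_fiberGroup (η : Δ →* affOrb M) (φ : Aff m) (δ : Δ) :
    ∃ α, prodAff α δ.1 ∈ fiberGroup η φ := by
  obtain ⟨g, hg⟩ := (η δ).2
  exact ⟨_, g, δ, hg, rfl⟩

theorem mem_conj_of_prodAff_one_mem (hM : IsSpaceGroup M) {η : Δ →* affOrb M} {φ α : Aff m}
    (h : prodAff α 1 ∈ fiberGroup η φ) : α ∈ conj φ M := by
  have h1 := (prodAff_mem_fiberGroup (δ := 1)).1 h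
  rw [map_one] at h1
  exact mem_conj.2 ⟨_, hM.mem_of_isLift_one h1, by group⟩

theorem prodAff_one_mem_fiberGroup (η : Δ →* affOrb M) {φ α : Aff m} (h : α ∈ conj φ M) :
    prodAff α 1 ∈ fiberGroup η φ := by
  obtain ⟨μ, hμ, rfl⟩ := mem_conj.1 h
  refine ⟨μ, 1, ?_, rfl⟩
  rw [map_one]
  exact isLift_one_of_mem hμ

/-- The extension of `φ M φ⁻¹` as a subgroup of `fiberGroup η φ`. -/
def fiberSubgroup (η : Δ →* affOrb M) (φ : Aff m) : Subgroup (fiberGroup η φ) :=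
  ((conj φ M).map (extendAff m k)).subgroupOf (fiberGroup η φ)

theorem mem_fiberSubgroup {η : Δ →* affOrb M} {φ : Aff m} {γ : fiberGroup η φ} :
    γ ∈ fiberSubgroup η φ ↔ ∃ μ ∈ conj φ M, γ.1 = prodAff μ 1 := by
  constructor
  · rintro ⟨μ, hμ, e⟩
    exact ⟨μ, hμ, e.symm⟩
  · rintro ⟨μ, hμ, e⟩
    exact ⟨μ, hμ, e.symm⟩

theorem fiberSubgroup_extension (η : Δ →* affOrb M) (φ : Aff m) (γ : Aff (m + k)) :
    (∃ h : γ ∈ fiberGroup η φ, (⟨γ, h⟩ : fiberGroup η φ) ∈ fiberSubgroup η φ) ↔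
      ∃ μ ∈ conj φ M, γ = prodAff μ 1 := by
  constructor
  · rintro ⟨h, hN⟩
    exact mem_fiberSubgroup.1 hN
  · rintro ⟨μ, hμ, rfl⟩
    exact ⟨prodAff_one_mem_fiberGroup η hμ, mem_fiberSubgroup.2 ⟨μ, hμ, rfl⟩⟩

theorem fiberSubgroup_normal (hM : IsSpaceGroup M) (η : Δ →* affOrb M) (φ : Aff m) :
    (fiberSubgroup η φ).Normal := by
  refine ⟨?_⟩
  rintro ν hν ⟨_, g, δ, hg, rfl⟩
  obtain ⟨_, hμ', e⟩ := mem_fiberSubgroup.1 hν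
  obtain ⟨μ, hμ, rfl⟩ := mem_conj.1 hμ'
  refine mem_fiberSubgroup.2 ⟨_, mem_conj.2 ⟨_, hg.conj_mem hM hμ, rfl⟩, ?_⟩
  change prodAff (φ * g * φ⁻¹) δ.1 * ν.1 * (prodAff (φ * g * φ⁻¹) δ.1)⁻¹ = _
  rw [e, prodAff_inv, prodAff_mul, prodAff_mul, mul_one, mul_inv_cancel]
  congr 1
  group

variable {η : Δ →* affOrb M} {φ : Aff m}

theorem isSpaceGroup_fiberGroup (hM : IsSpaceGroup M) (hΔ : IsSpaceGroup Δ)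
    (hM' : IsSpaceGroup (conj φ M))
    (hi : ∀ (δ : Δ) (g : Aff m), IsLift (η δ).1 g → Isometry (φ * g * φ⁻¹ : Aff m)) :
    IsSpaceGroup (fiberGroup η φ) := by
  choose l hl using fun δ : Δ => (η δ).2
  refine IsSpaceGroup.of_norm ?_ (fun R => ?_) ?_
  · rintro _ ⟨g, δ, h, rfl⟩
    exact isometry_prodAff (hi δ g h) (hΔ.isometry _ δ.2)
  · have hF : {δ : Δ | ‖δ.1 0‖ ≤ R}.Finite := by
      refine Set.Finite.of_finite_image ((hΔ.finite_norm_le R).subset ?_)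
        Subtype.val_injective.injOn
      rintro _ ⟨δ, h, rfl⟩
      exact ⟨δ.2, h⟩
    -- Only finitely many `δ` are short, and over each of them every lift is an element of `M` times
    -- a fixed lift `l δ`.
    refine (hF.biUnion fun δ _ => (hM'.finite_norm_le
      (R + ‖(φ * l δ * φ⁻¹ : Aff m) 0‖)).image
        fun μ => prodAff (μ * (φ * l δ * φ⁻¹)) δ.1).subset ?_
    rintro _ ⟨⟨g, δ, h, rfl⟩, hR⟩
    rw [prodAff_zero] at hR
    have h1 := (norm_fst_le_norm_pt _).trans hR
    have h2 := (norm_snd_le_norm_pt _).trans hR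
    obtain ⟨μ, hμ, rfl⟩ := hM.exists_mul_of_isLift h (hl δ)
    refine Set.mem_biUnion (x := δ) h2 ⟨φ * μ * φ⁻¹, ⟨mem_conj.2 ⟨μ, hμ, rfl⟩, ?_⟩, ?_⟩
    · have e : φ * (μ * l δ) * φ⁻¹ = (φ * μ * φ⁻¹) * (φ * l δ * φ⁻¹) := by group
      have h3 := norm_apply_sub_le (hM'.isometry _ (mem_conj.2 ⟨μ, hμ, rfl⟩))
        ((φ * l δ * φ⁻¹ : Aff m) 0)
      rw [← aff_mul_apply, ← e] at h3
      have h4 := norm_sub_norm_le ((φ * μ * φ⁻¹ : Aff m) 0)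
        ((φ * (μ * l δ) * φ⁻¹ : Aff m) 0)
      rw [norm_sub_rev] at h4
      change ‖(φ * (μ * l δ) * φ⁻¹ : Aff m) 0‖ ≤ R at h1
      linarith
    · change prodAff _ _ = prodAff _ _
      congr 1
      group
  · obtain ⟨R₁, h₁⟩ := hM'.exists_norm_le
    obtain ⟨R₂, h₂⟩ := hΔ.exists_norm_le
    refine ⟨R₁ + R₂, fun x => ?_⟩
    obtain ⟨z, rfl⟩ := pt_surjective x
    obtain ⟨δ, hδ, h4⟩ := h₂ z.2
    obtain ⟨α, hα⟩ := exists_prodAff_mem_fiberGroup η φ ⟨δ, hδ⟩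
    obtain ⟨μ, hμ, h5⟩ := h₁ (α z.1)
    -- `δ` first brings the second coordinate into a bounded region; `μ × 1` then corrects the first
    -- without disturbing the second.
    refine ⟨_, Subgroup.mul_mem _ (prodAff_one_mem_fiberGroup η hμ) hα, ?_⟩
    rw [prodAff_mul, prodAff_pt, one_mul]
    exact (norm_pt_le _).trans (add_le_add h5 h4)

theorem mem_spanOf_fiberSubgroup (hM' : IsSpaceGroup (conj φ M)) (z : E m × E k) :
    pt z ∈ spanOf (fiberSubgroup η φ) ↔ z.2 = 0 := by
  let J : E m →ₗ[ℝ] E (m + k) :=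
    { toFun := fun x => pt (x, 0)
      map_add' := fun x y => by rw [← pt_add, Prod.mk_add_mk, add_zero]
      map_smul' := fun c x => by rw [RingHom.id_apply, ← pt_smul, Prod.smul_mk, smul_zero] }
  have hspan : spanOf (fiberSubgroup η φ) = LinearMap.range J := by
    refine le_antisymm (Submodule.span_le.2 ?_) ?_
    · rintro a ⟨ν, hν, e⟩
      obtain ⟨μ, hμ, e'⟩ := mem_fiberSubgroup.1 hν
      refine ⟨μ 0, ?_⟩
      have := congrArg (fun g : Aff (m + k) => g 0) (e'.symm.trans e)
      simp only [prodAff_zero] at this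
      exact this.trans (add_zero a)
    · rw [LinearMap.range_eq_map, ← hM'.span_translations, Submodule.map_span]
      refine Submodule.span_mono ?_
      rintro _ ⟨v, hv, rfl⟩
      refine ⟨⟨_, prodAff_one_mem_fiberGroup η hv⟩, mem_fiberSubgroup.2 ⟨_, hv, rfl⟩, ?_⟩
      change prodAff (transl v) 1 = transl (pt (v, 0))
      ext1 x
      obtain ⟨w, rfl⟩ := pt_surjective x
      rw [prodAff_pt, transl_apply, transl_apply, ← pt_add]
      congr 1
      exact Prod.ext rfl (zero_add _).symm
  rw [hspan]
  constructor
  · rintro ⟨x, hx⟩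
    rw [← pt_injective hx]
  · intro h
    exact ⟨z.1, congrArg pt (Prod.ext rfl h.symm)⟩

theorem mem_spanOf_fiberSubgroup_orthogonal (hM' : IsSpaceGroup (conj φ M)) (z : E m × E k) :
    pt z ∈ (spanOf (fiberSubgroup η φ))ᗮ ↔ z.1 = 0 := by
  rw [Submodule.mem_orthogonal]
  constructor
  · intro h
    have := h (pt (z.1, 0)) ((mem_spanOf_fiberSubgroup hM' _).2 rfl)
    rw [inner_pt, inner_zero_left, add_zero] at this
    exact inner_self_eq_zero.1 this
  · intro h u hu
    obtain ⟨w, rfl⟩ := pt_surjective u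
    rw [inner_pt, h, (mem_spanOf_fiberSubgroup hM' _).1 hu, inner_zero_right, inner_zero_left,
      add_zero]

/-- The span of `N` is the factor `Eᵐ`. An element translating within it and linearly fixing `Eᵏ`
has `δ = 1`, so up to `φ` its first factor lifts the identity and belongs to `M`. -/
theorem isComplete_fiberSubgroup (hM : IsSpaceGroup M) (hM' : IsSpaceGroup (conj φ M)) :
    IsComplete (fiberSubgroup η φ) := by
  intro γ
  constructor
  · intro hγ
    obtain ⟨μ, hμ, e⟩ := mem_fiberSubgroup.1 hγ
    rw [e]
    refine ⟨?_, fun w hw => ?_⟩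
    · rw [prodAff_zero, mem_spanOf_fiberSubgroup hM']
      rfl
    · obtain ⟨z, rfl⟩ := pt_surjective w
      rw [← lin_apply, lin_prodAff_pt, map_one]
      rw [mem_spanOf_fiberSubgroup_orthogonal hM'] at hw
      rw [hw, map_zero]
      exact congrArg pt (Prod.ext hw.symm rfl)
  · obtain ⟨γ, hγ⟩ := γ
    obtain ⟨g, δ, hg, rfl⟩ := id hγ
    rintro ⟨h0, h1⟩
    have hδ : δ.1 = 1 := by
      refine aff_ext ?_ ?_
      · ext1 y
        have := h1 (pt (0, y)) ((mem_spanOf_fiberSubgroup_orthogonal hM' _).2 rfl)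
        rw [← lin_apply, lin_prodAff_pt] at this
        exact congrArg Prod.snd (pt_injective this)
      · change prodAff _ _ 0 ∈ _ at h0
        rw [prodAff_zero, mem_spanOf_fiberSubgroup hM'] at h0
        exact h0
    refine mem_fiberSubgroup.2 ⟨_, ?_, congrArg (prodAff _) hδ⟩
    rw [hδ] at hγ
    exact mem_conj_of_prodAff_one_mem hM hγ

theorem fiberGroup_splits (γ : Aff (m + k)) (h : γ ∈ fiberGroup η φ) :
    ∃ (α : Aff m) (δ : Aff k), γ = prodAff α δ := by
  obtain ⟨g, δ, -, rfl⟩ := h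
  exact ⟨_, _, rfl⟩

theorem fiberGroup_base (η : Δ →* affOrb M) (φ : Aff m) (δ : Aff k) :
    δ ∈ Δ ↔ ∃ α : Aff m, prodAff α δ ∈ fiberGroup η φ := by
  constructor
  · intro h
    exact exists_prodAff_mem_fiberGroup η φ ⟨δ, h⟩
  · rintro ⟨α, g, δ', -, e⟩
    rw [(prodAff_inj.1 e).2]
    exact δ'.2

/-- Every homomorphism with finite image to the group of affinities of an orbit space gives rise
to a pair. -/
theorem exists_arises (hM : IsSpaceGroup M) (hΔ : IsSpaceGroup Δ) (η : Δ →* affOrb M)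
    (hη : (Set.range η).Finite) : ∃ p : Pair Δ M, Arises η p := by
  let H : Subgroup (Equiv.Perm (Orb M)) := ((affOrb M).subtype.comp η).range
  have hH : Finite H := by
    have : (Set.range ((affOrb M).subtype.comp η)).Finite := by
      rw [MonoidHom.coe_comp, Set.range_comp]
      exact hη.image _
    exact this
  obtain ⟨C, hC⟩ := hM.exists_isometry_conj H
  set φ := C.toAffineEquiv with hφ
  have hi : ∀ (δ : Δ) (g : Aff m), IsLift (η δ).1 g → Isometry (φ * g * φ⁻¹ : Aff m) :=
    fun δ g h => hC _ ⟨δ, rfl⟩ g h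
  have hM' : IsSpaceGroup (conj φ M) := hM.conj C fun μ hμ => hC 1 H.one_mem μ (isLift_one_of_mem hμ)
  have hN := fiberSubgroup_normal hM η φ
  obtain ⟨e, -⟩ := exists_equiv_extension (fiberSubgroup_extension η φ)
  obtain ⟨β, -⟩ := exists_equiv_quotient (Δ := Δ) (fiberSubgroup_extension η φ)
    fiberGroup_splits (fiberGroup_base η φ) (fun _ => mem_conj_of_prodAff_one_mem hM)
  let c : M ≃* conj φ M := M.equivMapOfInjective _ (MulAut.conj φ).injective
  let p : Pair Δ M :=
    { Γ := fiberGroup η φ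
      spaceGroup := isSpaceGroup_fiberGroup hM hΔ hM' hi
      N := fiberSubgroup η φ
      normal := hN
      complete := isComplete_fiberSubgroup hM hM'
      isoM := ⟨(c.trans e).symm⟩
      isoΔ := ⟨β.symm⟩ }
  refine ⟨p, C, hM', fun δ => ?_, fiberSubgroup_extension η φ, fiberGroup_splits,
    fiberGroup_base η φ, fun α δ h x => ?_⟩
  · obtain ⟨g, hg⟩ := (η δ).2
    exact (hg.sharp φ).mem_isomOrb (hi δ g hg)
  · have h1 := (prodAff_mem_fiberGroup.1 h).sharp φ x
    have e : φ * (φ⁻¹ * α * φ) * φ⁻¹ = α := by group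
    rw [e] at h1
    exact h1

end Construction

/-! ### Classification of pairs by outer actions -/

section Classification

theorem SameOrbit.comp {D A B : Type*} [Group D] [Group A] [Group B] {η₁ η₂ : D →* A}
    (h : SameOrbit η₁ η₂) (f : A →* B) : SameOrbit (f.comp η₁) (f.comp η₂) := by
  obtain ⟨a, ζ, h⟩ := h
  refine ⟨f a, ζ, fun δ => ?_⟩
  rw [MonoidHom.comp_apply, h, map_mul, map_mul, map_inv]
  rfl

variable {m k : ℕ} {Δ : Subgroup (Aff k)} {M : Subgroup (Aff m)}

theorem Pair.nonempty_equiv_quotient (p : Pair Δ M) : Nonempty (Δ ≃* p.Γ ⧸ p.N) :=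
  p.isoΔ.map MulEquiv.symm

/-- The map `ω : Iso(Δ, M) → Out(Δ, M)`. -/
def omegaMap (Δ : Subgroup (Aff k)) (M : Subgroup (Aff m)) : IsoSet Δ M → OutSet Δ M :=
  Quotient.lift (fun p : Pair Δ M =>
    HomOut.cls ⟨p.outHom p.isoM.some p.nonempty_equiv_quotient.some, p.finite_range_outHom _ _⟩)
    fun _ _ h => Quotient.sound (s := outSetoid Δ M) (Pair.sameOrbit_outHom h _ _ _ _)

theorem omegaMap_cls (p : Pair Δ M) (α : p.N ≃* M) (β : Δ ≃* p.Γ ⧸ p.N) :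
    omegaMap Δ M p.cls = HomOut.cls ⟨p.outHom α β, p.finite_range_outHom α β⟩ :=
  Quotient.sound (s := outSetoid Δ M)
    (Pair.sameOrbit_outHom ((pairSetoid Δ M).refl p) _ _ _ _)

theorem isOmega_omegaMap : IsOmega Δ M (omegaMap Δ M) := fun p α β =>
  ⟨p.finite_range_outHom α β, omegaMap_cls p α β⟩

theorem omegaMap_injective (hc : Subgroup.center M = ⊥) : Function.Injective (omegaMap Δ M) := by
  intro x y
  induction x using Quotient.inductionOn with
  | h p =>
    induction y using Quotient.inductionOn with
    | h q =>
      intro h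
      exact Quotient.sound (Pair.iso_of_sameOrbit hc _ _ _ _
        (Quotient.exact (s := outSetoid Δ M) h))

variable (hM : IsSpaceGroup M)

/-- The map `Aff(Δ, M) → Out(Δ, M)` induced by `Ω`. -/
def omegaComp (Δ : Subgroup (Aff k)) : AffSet Δ hM → OutSet Δ M :=
  Quotient.lift (fun η : HomAff Δ hM => HomOut.cls ⟨(Omega hM).comp η.1, η.2⟩)
    fun _ _ h => Quotient.sound (s := outSetoid Δ M) (SameOrbit.comp h _)

theorem omegaComp_bijective (hc : Subgroup.center M = ⊥) :
    Function.Bijective (omegaComp hM Δ) := by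
  let e : affOrb M ≃* Out M :=
    MulEquiv.ofBijective (Omega hM) ⟨Omega_injective hM hc, Omega_surjective hM⟩
  have he : ∀ η : Δ →* affOrb M,
      e.symm.toMonoidHom.comp ((Omega hM).comp η) = η := fun η => by
    ext1 δ
    exact e.symm_apply_apply (η δ)
  have he' : ∀ θ : Δ →* Out M,
      (Omega hM).comp (e.symm.toMonoidHom.comp θ) = θ := fun θ => by
    ext1 δ
    exact e.apply_symm_apply (θ δ)
  constructor
  · intro x y
    induction x using Quotient.inductionOn with
    | h η₁ =>
      induction y using Quotient.inductionOn with
      | h η₂ =>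
        intro h
        have h1 : SameOrbit ((Omega hM).comp η₁.1) ((Omega hM).comp η₂.1) :=
          Quotient.exact (s := outSetoid Δ M) h
        have h2 := h1.comp e.symm.toMonoidHom
        rw [he, he] at h2
        exact Quotient.sound (s := affSetoid Δ hM) h2
  · intro y
    induction y using Quotient.inductionOn with
    | h θ =>
      refine ⟨HomAff.cls ⟨e.symm.toMonoidHom.comp θ.1, by rw [he']; exact θ.2⟩, ?_⟩
      exact congrArg HomOut.cls (Subtype.ext (he' θ.1))

theorem omegaMap_cls_of_arises {η : HomAff Δ hM} {p : Pair Δ M} (h : Arises η.1 p) :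
    omegaMap Δ M p.cls = omegaComp hM Δ η.cls := by
  obtain ⟨α, β, e⟩ := h.exists_outHom_eq hM
  rw [omegaMap_cls p α β]
  exact congrArg HomOut.cls (Subtype.ext e)

/-- Finiteness is given only for the image of `Ω η`; injectivity of `Omega` transfers it to `η`. -/
theorem HomAff.exists_arises (hc : Subgroup.center M = ⊥) (hΔ : IsSpaceGroup Δ)
    (η : HomAff Δ hM) : ∃ p : Pair Δ M, Arises η.1 p := by
  refine FlatOrbifold.exists_arises hM hΔ η.1 (Set.Finite.of_finite_image (f := Omega hM) ?_
    (Omega_injective hM hc).injOn)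
  rw [← Set.range_comp]
  exact η.2

theorem omegaMap_bijective (hM : IsSpaceGroup M) (hc : Subgroup.center M = ⊥)
    (hΔ : IsSpaceGroup Δ) :
    Function.Bijective (omegaMap Δ M) := by
  refine ⟨omegaMap_injective hc, fun y => ?_⟩
  obtain ⟨x, rfl⟩ := (omegaComp_bijective hM (Δ := Δ) hc).2 y
  induction x using Quotient.inductionOn with
  | h η =>
    obtain ⟨p, hp⟩ := η.exists_arises hM hc hΔ
    exact ⟨p.cls, omegaMap_cls_of_arises hM hp⟩

end Classification

end FlatOrbifold

end

theorem theorem20 (m k : ℕ) (hm : 0 < m) (hk : 0 < k)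
    (M : Subgroup (FlatOrbifold.Aff m)) (hM : FlatOrbifold.IsSpaceGroup M)
    (hcenter : Subgroup.center M = ⊥)
    (Δ : Subgroup (FlatOrbifold.Aff k)) (hΔ : FlatOrbifold.IsSpaceGroup Δ) :
    (∃ ψ : FlatOrbifold.AffSet Δ hM → FlatOrbifold.IsoSet Δ M,
      FlatOrbifold.IsPsi Δ hM ψ ∧ Function.Bijective ψ) ∧
    (∃ ω : FlatOrbifold.IsoSet Δ M → FlatOrbifold.OutSet Δ M,
      FlatOrbifold.IsOmega Δ M ω ∧ Function.Bijective ω) := by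
  have hω := FlatOrbifold.omegaMap_bijective hM hcenter hΔ
  have hΩ := FlatOrbifold.omegaComp_bijective hM (Δ := Δ) hcenter
  -- With ψ defined as the inverse of ω after `omegaComp`, bijectivity is immediate; agreement with
  -- the construction is checked after applying ω, so independence of the choice of `p` comes for
  -- free.
  refine ⟨⟨(Equiv.ofBijective _ hω).symm ∘ FlatOrbifold.omegaComp hM Δ, fun η =>
    ⟨η.exists_arises hM hcenter hΔ, fun p hp => ?_⟩, (Equiv.bijective _).comp hΩ⟩,
    FlatOrbifold.omegaMap Δ M, FlatOrbifold.isOmega_omegaMap, hω⟩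
  rw [Function.comp_apply, Equiv.symm_apply_eq]
  exact (FlatOrbifold.omegaMap_cls_of_arises hM hp).symm
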